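/- Let $p\ge 1$, let $0<\theta_1<\theta_2<\dots<\theta_p$, and let $X=\sum_{i=1}^{p}\frac{1}{2\theta_i}\chi^2_1$, a linear combination of independent (central) chi-square random variables with one degree of freedom. Then $X$ is positive almost surely and has a probability density function $f_{\theta}$ that is continuous on $(0,\infty)$ and is given, for $s>0$, by $$ f_{\theta}(s)=\frac{\prod_{i=1}^{p}\sqrt{\theta_i}}{\pi}\sum_{r=1}^{\lfloor (p+1)/2\rfloor}(-1)^{r+1}\int_{\theta_{2r-1}}^{\theta_{2r}}\frac{e^{-st}}{\sqrt{-\prod_{i=1}^{p}(\theta_i-t)}}\,dt , $$ where the last upper limit $\theta_{2\lfloor (p+1)/2\rfloor}$ is $\theta_p$ if $p$ is even and $\infty$ if $p$ is odd, and all these integrals converge absolutely. Moreover, let $\theta_0>0$ be arbitrary and, for $c>0$, let $f_{\tilde\theta c}$ denote the probability density function, continuous on $(0,\infty)$, of $$ \frac{1}{2\theta_0 c}\chi^2_2+\sum_{i=1}^{p}\frac{1}{2(\theta_i+\theta_0)c}\chi^2_1 $$ (independent central chi-square variables with two and one degrees of freedom), so that $f_{\tilde\theta}=f_{\tilde\theta\cdot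 1}$ is the density of $\tilde X=\frac{1}{2\theta_0}\chi^2_2+\sum_{i=1}^{p}\frac{1}{2(\theta_i+\theta_0)}\chi^2_1$. These densities exist, and for all $x>0$ $$ P(X\le x)=f_{\tilde\theta}(x)\,\frac{e^{x\theta_0}\prod_{i=1}^{p}\sqrt{\theta_i}}{\theta_0\prod_{i=1}^{p}\sqrt{\theta_i+\theta_0}} =f_{\tilde\theta x}(1)\,\frac{e^{x\theta_0}\prod_{i=1}^{p}\sqrt{\theta_i}}{x\,\theta_0\prod_{i=1}^{p}\sqrt{\theta_i+\theta_0}} . $$ -/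

import Mathlib

open MeasureTheory ProbabilityTheory

noncomputable section

/-- The (central) chi-square distribution with `n` degrees of freedom: the law of
`Z₁² + ⋯ + Zₙ²` for independent standard normal variables `Z₁, …, Zₙ`. -/
def chiSquared (n : ℕ) : Measure ℝ :=
  (Measure.pi (fun _ : Fin n => gaussianReal 0 1)).map (fun z => ∑ j, z j ^ 2)

/-- The law of the linear combination `∑ i, 1 / (2 θ i) * C i` of independent variables
`C i`, where `C i` is chi-square distributed with `n i` degrees of freedom. -/
def chiSqCombLaw {p : ℕ} (θ : Fin p → ℝ) (n : Fin p → ℕ) : Measure ℝ :=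
  (Measure.pi (fun i => chiSquared (n i))).map (fun c => ∑ i, 1 / (2 * θ i) * c i)

/-- `f` is, on the positive half-line, the (continuous version of the) probability density
function of `μ`, and `μ` is carried by the positive half-line. Continuity and nonnegativity
make the values `f s`, `s > 0`, unique; the values of `f` at `s ≤ 0` play no role. -/
structure IsPosPDF (μ : Measure ℝ) (f : ℝ → ℝ) : Prop where
  continuousOn : ContinuousOn f (Set.Ioi 0)
  nonneg : ∀ s, 0 < s → 0 ≤ f s
  eq_withDensity : μ = (volume.restrict (Set.Ioi 0)).withDensity (fun s => ENNReal.ofReal (f s))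

/-- The `r`-th interval of integration (`r` counted from `0`, and `θ` indexed from `0`):
from `θ (2r)` to `θ (2r+1)`, where the upper end is `∞` if `θ (2r)` is the last entry. -/
def cutInterval {p : ℕ} (θ : Fin p → ℝ) (r : Fin ((p + 1) / 2)) : Set ℝ :=
  if h : 2 * (r : ℕ) + 1 < p then
    Set.Ioo (θ ⟨2 * (r : ℕ), by omega⟩) (θ ⟨2 * (r : ℕ) + 1, h⟩)
  else
    Set.Ioi (θ ⟨2 * (r : ℕ), by omega⟩)

/-- The integrand `e^{-st} / √(-∏ᵢ (θᵢ - t))`. -/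
def cutIntegrand {p : ℕ} (θ : Fin p → ℝ) (s t : ℝ) : ℝ :=
  Real.exp (-(s * t)) / Real.sqrt (-∏ i, (θ i - t))

/-- The alternating sum of integrals, times `∏ᵢ √θᵢ / π`. As `r` is counted from `0`, the
sign of the `r`-th term is `(-1)^r`. -/
def cutDensity {p : ℕ} (θ : Fin p → ℝ) (s : ℝ) : ℝ :=
  (∏ i, Real.sqrt (θ i)) / Real.pi *
    ∑ r : Fin ((p + 1) / 2), (-1 : ℝ) ^ (r : ℕ) * ∫ t in cutInterval θ r, cutIntegrand θ s t

/-- The parameters `(θ₀, θ₁ + θ₀, …, θₚ + θ₀)` of the augmented variable. -/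
def augParam {p : ℕ} (θ : Fin p → ℝ) (θ₀ : ℝ) : Fin (p + 1) → ℝ :=
  Fin.cons θ₀ (fun i => θ i + θ₀)

/-- The degrees of freedom `(2, 1, …, 1)` of the augmented variable. -/
def augDof (p : ℕ) : Fin (p + 1) → ℕ :=
  Fin.cons 2 (fun _ => 1)

end

/-! Up to the factor `∏ i, √(θ i)`, the characteristic function of `X` at `u > 0` is the value at
`iu` of `prodInvSqrt θ`. This product of principal inverse square roots is holomorphic in the upper
half-plane and decays at least like `‖z‖ ^ (-1/2)`. At a real `t` it has the boundary value `I ^ k *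
∏ i, (√|t - θ i|)⁻¹`, where `k` is the number of `θ j` below `t`. The imaginary part vanishes for
even `k` and has sign `(-1) ^ r` for `k = 2 * r + 1`, which is exactly the alternating pattern of
the cut intervals.

Contour integration against `1 / (t + iu)` and `1 / (t - iu)`, combined by conjugation, recovers the
function from that imaginary part (`integral_im_prodInvSqrtBoundary_div`). Writing `1 / (t - iu)` as
`∫ exp ((iu - t) s) ds` over `s > 0` and using Fubini identifies the Fourier transform of
`cutDensity θ` with the characteristic function (`integral_cexp_mul_cutDensity`). The alternating
sum is not visibly nonnegative; `isPosPDF_of_charFun` deduces this from uniqueness for finite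
measures, applied to its positive and negative parts.

For the distribution function `F` of `X`, the Fourier transform of `exp (-θ₀ x) * F x` at `u` is `1
/ (θ₀ - iu)` times the transform of `X` at `iu - θ₀`. The first factor is, up to `θ₀`, the
characteristic function of `χ²₂ / (2 θ₀)`; the second is, up to constants, that of the sum with
parameters `θ i + θ₀`. So `exp (-θ₀ x) * F x` is a multiple of the augmented density
(`isPosPDF_augmented`). The scaled formula is the same identity for `X / x` at the point `1`. -/

open Filter Topology

/-! ### Contour integrals along horizontal lines -/

/-- The integral of a holomorphic function decaying like `‖z‖ ^ (-3/2)` along a horizontal line of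
the upper half-plane vanishes. -/
theorem integral_horizontal_line_eq_zero {F : ℂ → ℂ} {C R₀ ε : ℝ} (hε : 0 < ε)
    (hF : DifferentiableOn ℂ F {z | 0 < z.im})
    (hdecay : ∀ z : ℂ, R₀ ≤ ‖z‖ → 0 < z.im → ‖F z‖ ≤ C * ‖z‖ ^ (-(3 / 2) : ℝ))
    (hint : Integrable (fun t : ℝ => F (t + ε * Complex.I))) :
    ∫ t : ℝ, F (t + ε * Complex.I) = 0 := by
  have hlim : Tendsto (fun R : ℝ => ∫ t in (-R)..R, F (t + ε * Complex.I)) atTop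
      (𝓝 (∫ t : ℝ, F (t + ε * Complex.I))) :=
    intervalIntegral_tendsto_integral hint tendsto_neg_atTop_atBot tendsto_id
  -- The constant 4 is the total length, in units of `R`, of the other three sides of the rectangle:
  -- `2R` for the top and `R` for each vertical side.
  refine tendsto_nhds_unique hlim (squeeze_zero_norm' (a := fun R : ℝ => 4 * |C| * R ^ (-(1 / 2) : ℝ))
    ?_ ?_)
  · filter_upwards [eventually_ge_atTop R₀, eventually_gt_atTop 0] with R hR hR0
    have hb : ∀ z : ℂ, R ≤ ‖z‖ → 0 < z.im → ‖F z‖ ≤ |C| * R ^ (-(3 / 2) : ℝ) := by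
      intro z hz him
      refine (hdecay z (hR.trans hz) him).trans (mul_le_mul (le_abs_self C) ?_ (by positivity)
        (abs_nonneg C))
      exact Real.rpow_le_rpow_of_nonpos hR0 hz (by norm_num)
    -- The rectangle is `[-R, R] × [ε, ε + R]`; all points of its other three sides have norm at
    -- least `R`.
    have hrect := Complex.integral_boundary_rect_eq_zero_of_differentiableOn F
      (-R + ε * Complex.I) (R + (ε + R) * Complex.I) (hF.mono (by
        intro z hz
        have h2 := hz.2
        simp only [Set.mem_preimage, Complex.add_im, Complex.neg_im, Complex.ofReal_im,
          Complex.mul_im, Complex.ofReal_re, Complex.I_im, Complex.I_re, Complex.add_re] at h2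
        rw [Set.uIcc_of_le (by linarith)] at h2
        simp only [Set.mem_ofPred_eq]
        have := h2.1
        simp at this
        linarith))
    simp only [Complex.add_im, Complex.neg_im, Complex.ofReal_im,
          Complex.mul_im, Complex.ofReal_re, Complex.I_im, Complex.I_re, Complex.add_re,
          Complex.neg_re, Complex.mul_re, mul_one, mul_zero, add_zero, zero_add,
          sub_zero, neg_zero] at hrect
    have hrw : R * R ^ (-(3 / 2) : ℝ) = R ^ (-(1 / 2) : ℝ) := by
      rw [← Real.rpow_one_add' hR0.le (by norm_num)]; norm_num
    have h1 : ‖∫ x : ℝ in (-R)..R, F (x + (ε + R : ℝ) * Complex.I)‖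
        ≤ |C| * R ^ (-(3 / 2) : ℝ) * |R - -R| := by
      refine intervalIntegral.norm_integral_le_of_norm_le_const fun x _ => hb _ ?_ ?_
      · refine le_trans ?_ (Complex.abs_im_le_norm _)
        simp
        rw [abs_of_pos (by linarith)]; linarith
      · simp; linarith
    have h2 : ‖∫ y : ℝ in ε..(ε + R), F ((R : ℝ) + y * Complex.I)‖
        ≤ |C| * R ^ (-(3 / 2) : ℝ) * |ε + R - ε| := by
      refine intervalIntegral.norm_integral_le_of_norm_le_const fun y hy => hb _ ?_ ?_
      · refine le_trans ?_ (Complex.abs_re_le_norm _)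
        simp [abs_of_pos hR0]
      · rw [Set.uIoc_of_le (by linarith)] at hy
        simp; linarith [hy.1]
    have h3 : ‖∫ y : ℝ in ε..(ε + R), F ((-R : ℝ) + y * Complex.I)‖
        ≤ |C| * R ^ (-(3 / 2) : ℝ) * |ε + R - ε| := by
      refine intervalIntegral.norm_integral_le_of_norm_le_const fun y hy => hb _ ?_ ?_
      · refine le_trans ?_ (Complex.abs_re_le_norm _)
        simp [abs_of_pos hR0]
      · rw [Set.uIoc_of_le (by linarith)] at hy
        simp; linarith [hy.1]
    have e : (∫ x : ℝ in (-R)..R, F (x + ε * Complex.I))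
        = (∫ x : ℝ in (-R)..R, F (x + (ε + R : ℝ) * Complex.I))
          - Complex.I • (∫ y : ℝ in ε..(ε + R), F ((R : ℝ) + y * Complex.I))
          + Complex.I • (∫ y : ℝ in ε..(ε + R), F ((-R : ℝ) + y * Complex.I)) := by
      linear_combination hrect
    rw [e]
    refine (norm_add_le _ _).trans ?_
    refine (add_le_add_left (norm_sub_le _ _) _).trans ?_
    rw [norm_smul, norm_smul, Complex.norm_I, one_mul, one_mul]
    rw [abs_of_pos (by linarith : 0 < R - -R)] at h1
    rw [abs_of_pos (by linarith : 0 < ε + R - ε)] at h2 h3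
    rw [← hrw]
    linarith
  · simpa using (tendsto_rpow_neg_atTop (by norm_num : (0 : ℝ) < 1 / 2)).const_mul (4 * |C|)

/-- The integral of the boundary values on `ℝ` of a holomorphic function on the upper half-plane
that decays like `‖z‖ ^ (-3/2)` vanishes. -/
theorem integral_boundaryValue_eq_zero {F : ℂ → ℂ} {F₀ : ℝ → ℂ} {h : ℝ → ℝ} {C R₀ δ : ℝ} (hδ : 0 < δ)
    (hF : DifferentiableOn ℂ F {z | 0 < z.im})
    (hdecay : ∀ z : ℂ, R₀ ≤ ‖z‖ → 0 < z.im → ‖F z‖ ≤ C * ‖z‖ ^ (-(3 / 2) : ℝ))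
    (hh : Integrable h)
    (hbound : ∀ ε, 0 < ε → ε < δ → ∀ᵐ t : ℝ, ‖F (t + ε * Complex.I)‖ ≤ h t)
    (hlim : ∀ᵐ t : ℝ, Tendsto (fun ε : ℝ => F (t + ε * Complex.I)) (𝓝[>] 0) (𝓝 (F₀ t))) :
    ∫ t, F₀ t = 0 := by
  have hmeas : ∀ ε : ℝ, 0 < ε → AEStronglyMeasurable (fun t : ℝ => F (t + ε * Complex.I)) := by
    intro ε hε
    refine Continuous.aestronglyMeasurable ?_
    refine hF.continuousOn.comp_continuous (by fun_prop) fun t => ?_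
    simpa using hε
  have hev : ∀ᶠ ε : ℝ in 𝓝[>] 0, 0 < ε ∧ ε < δ := by
    filter_upwards [Ioo_mem_nhdsGT hδ] with ε hε using hε
  have ht : Tendsto (fun ε : ℝ => ∫ t : ℝ, F (t + ε * Complex.I)) (𝓝[>] 0) (𝓝 (∫ t, F₀ t)) := by
    refine tendsto_integral_filter_of_dominated_convergence h ?_ ?_ hh hlim
    · filter_upwards [hev] with ε hε using hmeas ε hε.1
    · filter_upwards [hev] with ε hε using hbound ε hε.1 hε.2
  refine tendsto_nhds_unique ht (Tendsto.congr' ?_ tendsto_const_nhds)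
  filter_upwards [hev] with ε hε
  exact (integral_horizontal_line_eq_zero hε.1 hF hdecay
    (hh.mono' (hmeas ε hε.1) (hbound ε hε.1 hε.2))).symm

/-! ### Integrable majorants with inverse square root singularities -/

/-- The comparison is with `t ^ (-1/2)` near `0` and `t ^ (-3/2)` at infinity. All later dominations
reduce to this function and its translates. -/
theorem integrable_inv_sqrt_abs_mul_inv_one_add_abs :
    Integrable (fun t : ℝ => (√|t|)⁻¹ * (1 + |t|)⁻¹) := by
  have hI : IntegrableOn (fun t : ℝ => (√t)⁻¹ * (1 + t)⁻¹) (Set.Ioi 0) := by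
    have hm : Measurable (fun t : ℝ => (√t)⁻¹ * (1 + t)⁻¹) := by fun_prop
    rw [← Set.Ioc_union_Ioi_eq_Ioi zero_le_one]
    refine IntegrableOn.union ?_ ?_
    · have h1 : IntegrableOn (fun t : ℝ => t ^ (-(1 / 2) : ℝ)) (Set.Ioc 0 1) :=
        (intervalIntegral.intervalIntegrable_rpow' (by norm_num)).1
      refine Integrable.mono' h1 hm.aestronglyMeasurable ?_
      refine (ae_restrict_iff' measurableSet_Ioc).2 (ae_of_all _ fun t ht => ?_)
      have h0 : 0 < t := ht.1
      rw [Real.norm_of_nonneg (by positivity), Real.rpow_neg h0.le, ← Real.sqrt_eq_rpow]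
      refine mul_le_of_le_one_right (by positivity) (inv_le_one_of_one_le₀ (by linarith))
    · have h1 : IntegrableOn (fun t : ℝ => t ^ (-(3 / 2) : ℝ)) (Set.Ioi 1) :=
        integrableOn_Ioi_rpow_of_lt (by norm_num) one_pos
      refine Integrable.mono' h1 hm.aestronglyMeasurable ?_
      refine (ae_restrict_iff' measurableSet_Ioi).2 (ae_of_all _ fun t ht => ?_)
      have h0 : 0 < t := one_pos.trans ht
      have : t ^ (-(3 / 2) : ℝ) = (√t)⁻¹ * t⁻¹ := by
        rw [Real.sqrt_eq_rpow, ← Real.rpow_neg h0.le, ← Real.rpow_neg_one t, ← Real.rpow_add h0]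
        norm_num
      rw [Real.norm_of_nonneg (by positivity), this]
      gcongr
      linarith
  have hI' : IntegrableOn (fun t : ℝ => (√|t|)⁻¹ * (1 + |t|)⁻¹) (Set.Ioi 0) :=
    hI.congr_fun (fun t ht => by simp only [abs_of_pos (Set.mem_Ioi.1 ht)]) measurableSet_Ioi
  rw [← integrableOn_univ, ← Set.Iic_union_Ioi (a := (0 : ℝ))]
  refine IntegrableOn.union ?_ hI'
  have h0 : IntegrableOn (fun t : ℝ => (√|t|)⁻¹ * (1 + |t|)⁻¹) (Set.Ici (-0)) := by
    rw [neg_zero, integrableOn_Ici_iff_integrableOn_Ioi]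
    exact hI'
  have := h0.comp_neg_Iic
  simpa using this

theorem integrable_inv_sqrt_abs_sub_mul_inv_one_add_abs (a : ℝ) :
    Integrable (fun t : ℝ => (√|t - a|)⁻¹ * (1 + |t|)⁻¹) := by
  have h := (integrable_inv_sqrt_abs_mul_inv_one_add_abs.comp_sub_right a).const_mul (1 + |a|)
  refine h.mono' (by fun_prop) (ae_of_all _ fun t => ?_)
  rw [Real.norm_of_nonneg (by positivity)]
  have h1 : 1 + |t - a| ≤ (1 + |a|) * (1 + |t|) := by
    have := abs_sub t a
    nlinarith [mul_nonneg (abs_nonneg a) (abs_nonneg t)]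
  have h2 : (1 + |t|)⁻¹ ≤ (1 + |a|) * (1 + |t - a|)⁻¹ := by
    rw [inv_eq_one_div, ← div_eq_mul_inv, div_le_div_iff₀ (by positivity) (by positivity)]
    linarith
  calc _ ≤ (√|t - a|)⁻¹ * ((1 + |a|) * (1 + |t - a|)⁻¹) := by gcongr
    _ = _ := by ring

/-- A product of inverse square root singularities at distinct points is bounded by a multiple of
their sum. -/
theorem exists_prod_inv_sqrt_le_sum {p : ℕ} (hp : 1 ≤ p) {θ : Fin p → ℝ}
    (hθ : Function.Injective θ) :
    ∃ C, 0 ≤ C ∧ ∀ t, ∏ i, (√|t - θ i|)⁻¹ ≤ C * ∑ i, (√|t - θ i|)⁻¹ := by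
  have : Nonempty (Fin p) := ⟨⟨0, hp⟩⟩
  obtain ⟨δ, hδ, hsep⟩ : ∃ δ > 0, ∀ i j, i ≠ j → 2 * δ ≤ |θ i - θ j| := by
    have hfin : ∀ q : Fin p × Fin p, ∃ δ > 0, q.1 ≠ q.2 → 2 * δ ≤ |θ q.1 - θ q.2| := by
      intro q
      by_cases hq : q.1 = q.2
      · exact ⟨1, one_pos, fun h => absurd hq h⟩
      · have : 0 < |θ q.1 - θ q.2| := abs_pos.2 (sub_ne_zero.2 (hθ.ne hq))
        exact ⟨|θ q.1 - θ q.2| / 2, by positivity, fun _ => by linarith⟩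
    choose d hd0 hd using hfin
    refine ⟨Finset.univ.inf' Finset.univ_nonempty d, by simpa using hd0, fun i j hij => ?_⟩
    have := Finset.inf'_le d (Finset.mem_univ (i, j))
    linarith [hd (i, j) hij]
  refine ⟨(√δ)⁻¹ ^ (p - 1), by positivity, fun t => ?_⟩
  -- Only the factor of the nearest `θ i` can be large: for `j ≠ i`, `2 * δ ≤ |θ j - θ i| ≤ 2 * |t -
  -- θ j|`.
  obtain ⟨i, hi⟩ := Finite.exists_min fun i => |t - θ i|
  have hfar : ∀ j, j ≠ i → δ ≤ |t - θ j| := by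
    intro j hj
    have h1 := hsep j i hj
    have h2 : |θ j - θ i| ≤ |t - θ i| + |t - θ j| := by
      have := abs_sub (t - θ i) (t - θ j)
      rwa [show t - θ i - (t - θ j) = θ j - θ i by ring] at this
    linarith [hi j]
  rw [← Finset.mul_prod_erase _ _ (Finset.mem_univ i), mul_comm]
  refine mul_le_mul ?_ ?_ (by positivity) (by positivity)
  · calc ∏ j ∈ Finset.univ.erase i, (√|t - θ j|)⁻¹ ≤ ∏ j ∈ Finset.univ.erase i, (√δ)⁻¹ := by
          refine Finset.prod_le_prod (fun _ _ => by positivity) fun j hj => ?_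
          have := Real.sqrt_pos.2 hδ
          gcongr
          exact hfar j (Finset.ne_of_mem_erase hj)
      _ = _ := by simp
  · exact Finset.single_le_sum (f := fun j => (√|t - θ j|)⁻¹) (fun _ _ => by positivity)
      (Finset.mem_univ i)

theorem integrable_prod_inv_sqrt_mul_inv_one_add_abs {p : ℕ} (hp : 1 ≤ p) {θ : Fin p → ℝ}
    (hθ : Function.Injective θ) :
    Integrable (fun t : ℝ => (∏ i, (√|t - θ i|)⁻¹) * (1 + |t|)⁻¹) := by
  obtain ⟨C, hC, h⟩ := exists_prod_inv_sqrt_le_sum hp hθ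
  have hs : Integrable (fun t : ℝ => C * ∑ i, (√|t - θ i|)⁻¹ * (1 + |t|)⁻¹) :=
    (integrable_finsetSum _ fun i _ =>
      integrable_inv_sqrt_abs_sub_mul_inv_one_add_abs (θ i)).const_mul C
  refine hs.mono' (by fun_prop) (ae_of_all _ fun t => ?_)
  rw [Real.norm_of_nonneg (mul_nonneg (Finset.prod_nonneg fun _ _ => by positivity)
    (by positivity)), ← Finset.sum_mul, ← mul_assoc]
  exact mul_le_mul_of_nonneg_right (h t) (by positivity)

/-! ### Products of principal inverse square roots and their boundary values -/

theorem norm_cpow_neg_half (w : ℂ) : ‖w ^ (-(1 / 2) : ℂ)‖ = (√‖w‖)⁻¹ := by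
  have := Complex.norm_cpow_real w (-(1 / 2))
  push_cast at this
  rw [this, Real.rpow_neg (norm_nonneg _), ← Real.sqrt_eq_rpow]

theorem ofReal_cpow_neg_half {x : ℝ} (hx : 0 ≤ x) :
    (x : ℂ) ^ (-(1 / 2) : ℂ) = ((√x)⁻¹ : ℝ) := by
  rw [Real.sqrt_eq_rpow, ← Real.rpow_neg hx, Complex.ofReal_cpow hx]
  push_cast
  rfl

/-- The boundary value of `(a - z) ^ (-1/2)` from the upper half-plane. -/
theorem tendsto_sub_cpow_neg_half {a t : ℝ} (h : t ≠ a) :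
    Tendsto (fun ε : ℝ => ((a : ℂ) - (t + ε * Complex.I)) ^ (-(1 / 2) : ℂ)) (𝓝[>] 0)
      (𝓝 ((if t < a then 1 else Complex.I) * ((√|t - a|)⁻¹ : ℝ))) := by
  have hbase : Tendsto (fun ε : ℝ => (a : ℂ) - (t + ε * Complex.I)) (𝓝[>] 0)
      (𝓝 ((a - t : ℝ) : ℂ)) := by
    have : Continuous (fun ε : ℝ => (a : ℂ) - (t + ε * Complex.I)) := by fun_prop
    have h0 := (this.tendsto 0).mono_left (nhdsWithin_le_nhds (s := Set.Ioi 0))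
    simpa using h0
  rcases lt_or_gt_of_ne h with h | h
  · have hlim := (continuousAt_cpow_const (b := (-(1 / 2) : ℂ))
      (Complex.ofReal_mem_slitPlane.2 (sub_pos.2 h))).tendsto.comp hbase
    rw [ofReal_cpow_neg_half (sub_pos.2 h).le] at hlim
    rw [if_pos h, one_mul, abs_sub_comm, abs_of_pos (sub_pos.2 h)]
    exact hlim
  · have hre : ((a - t : ℝ) : ℂ).re < 0 := by simpa using h
    -- The base approaches the negative axis from below, where the logarithm tends to `log |t - a| -
    -- iπ`; the exponent `-1/2` turns `-iπ` into the factor `exp (iπ/2) = I`.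
    have hw : Tendsto (fun ε : ℝ => (a : ℂ) - (t + ε * Complex.I)) (𝓝[>] 0)
        (𝓝[{z : ℂ | z.im < 0}] ((a - t : ℝ) : ℂ)) := by
      refine tendsto_nhdsWithin_iff.2 ⟨hbase, ?_⟩
      filter_upwards [self_mem_nhdsWithin] with ε hε
      simpa using hε
    have hlog := (Complex.tendsto_log_nhdsWithin_im_neg_of_re_neg_of_im_zero hre
      (Complex.ofReal_im _)).comp hw
    have hexp := (Complex.continuous_exp.tendsto _).comp (hlog.mul_const (-(1 / 2) : ℂ))
    have hval : Complex.exp ((Real.log ‖((a - t : ℝ) : ℂ)‖ - Real.pi * Complex.I) * (-(1 / 2)))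
        = Complex.I * ((√|t - a|)⁻¹ : ℝ) := by
      rw [Complex.norm_real, Real.norm_eq_abs, abs_sub_comm a t]
      have hpos : 0 < |t - a| := abs_pos.2 (sub_ne_zero.2 h.ne')
      rw [show ((Real.log |t - a| : ℂ) - Real.pi * Complex.I) * (-(1 / 2))
        = Real.pi / 2 * Complex.I + ((Real.log |t - a| * (-(1 / 2)) : ℝ) : ℂ) by push_cast; ring,
        Complex.exp_add, Complex.exp_pi_div_two_mul_I, ← Complex.ofReal_exp,
        ← Real.rpow_def_of_pos hpos, Real.rpow_neg hpos.le, ← Real.sqrt_eq_rpow]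
    rw [hval] at hexp
    rw [if_neg (not_lt.2 h.le)]
    refine hexp.congr' ?_
    filter_upwards [self_mem_nhdsWithin] with ε hε
    rw [Complex.cpow_def_of_ne_zero]
    · rfl
    · intro h0
      have := congrArg Complex.im h0
      simp at this
      exact (ne_of_gt hε) this

/-- `∏ i, (θ i - z) ^ (-1/2)`, with principal branches. -/
noncomputable def prodInvSqrt {p : ℕ} (θ : Fin p → ℝ) (z : ℂ) : ℂ :=
  ∏ i, ((θ i : ℂ) - z) ^ (-(1 / 2) : ℂ)

/-- The boundary values of `prodInvSqrt` on the real line from the upper half-plane. -/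
noncomputable def prodInvSqrtBoundary {p : ℕ} (θ : Fin p → ℝ) (t : ℝ) : ℂ :=
  ∏ i, ((if t < θ i then 1 else Complex.I) * ((√|t - θ i|)⁻¹ : ℝ))

section

variable {p : ℕ} {θ : Fin p → ℝ}

theorem measurable_prodInvSqrtBoundary : Measurable (prodInvSqrtBoundary θ) := by
  refine Finset.measurable_fun_prod _ fun i _ => ?_
  refine Measurable.mul (Measurable.ite (measurableSet_lt measurable_id measurable_const)
    measurable_const measurable_const) (by fun_prop)

theorem norm_prodInvSqrtBoundary (t : ℝ) :
    ‖prodInvSqrtBoundary θ t‖ = ∏ i, (√|t - θ i|)⁻¹ := by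
  rw [prodInvSqrtBoundary, norm_prod]
  refine Finset.prod_congr rfl fun i _ => ?_
  rw [norm_mul, Complex.norm_real, Real.norm_of_nonneg (by positivity)]
  split_ifs <;> simp

theorem ae_ne_all (θ : Fin p → ℝ) : ∀ᵐ t : ℝ, ∀ i, t ≠ θ i :=
  ae_all_iff.2 fun i => Measure.ae_ne volume (θ i)

theorem tendsto_prodInvSqrt {t : ℝ} (ht : ∀ i, t ≠ θ i) :
    Tendsto (fun ε : ℝ => prodInvSqrt θ (t + ε * Complex.I)) (𝓝[>] 0)
      (𝓝 (prodInvSqrtBoundary θ t)) :=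
  tendsto_finsetProd _ fun i _ => tendsto_sub_cpow_neg_half (ht i)

theorem differentiableOn_prodInvSqrt :
    DifferentiableOn ℂ (prodInvSqrt θ) {z | 0 < z.im} := by
  refine DifferentiableOn.fun_finsetProd fun i _ => ?_
  intro z hz
  refine DifferentiableAt.differentiableWithinAt ?_
  refine DifferentiableAt.cpow (by fun_prop) (by fun_prop) (Or.inr ?_)
  have : (0 : ℝ) < z.im := hz
  simpa using this.ne'

/-- Moving off the real axis only increases the distance to each `θ i`. The bound does not depend on
`ε`, as dominated convergence requires. -/
theorem norm_prodInvSqrt_le {t : ℝ} (ht : ∀ i, t ≠ θ i) (ε : ℝ) :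
    ‖prodInvSqrt θ (t + ε * Complex.I)‖ ≤ ∏ i, (√|t - θ i|)⁻¹ := by
  rw [prodInvSqrt, norm_prod]
  refine Finset.prod_le_prod (fun _ _ => norm_nonneg _) fun i _ => ?_
  rw [norm_cpow_neg_half]
  have hpos : 0 < √|t - θ i| := Real.sqrt_pos.2 (abs_pos.2 (sub_ne_zero.2 (ht i)))
  gcongr
  refine le_trans ?_ (Complex.abs_re_le_norm _)
  simp [abs_sub_comm]

/-- A single factor supplies the decay; far from the origin the remaining ones have norm at most 1.
Division by one linear factor then yields the exponent `-3/2` needed for the contour argument. -/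
theorem exists_norm_prodInvSqrt_le (hp : 1 ≤ p) (θ : Fin p → ℝ) :
    ∃ R₀, ∀ z : ℂ, R₀ ≤ ‖z‖ → ‖prodInvSqrt θ z‖ ≤ 2 * ‖z‖ ^ (-(1 / 2) : ℝ) := by
  refine ⟨2 * (1 + ∑ i, |θ i|), fun z hz => ?_⟩
  have hfac : ∀ i, ‖z‖ / 2 ≤ ‖(θ i : ℂ) - z‖ ∧ 1 ≤ ‖(θ i : ℂ) - z‖ := by
    intro i
    have h1 : |θ i| ≤ ∑ i, |θ i| :=
      Finset.single_le_sum (f := fun i => |θ i|) (fun _ _ => abs_nonneg _) (Finset.mem_univ i)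
    have h2 := norm_sub_norm_le z (θ i)
    rw [Complex.norm_real, Real.norm_eq_abs, norm_sub_rev] at h2
    have h3 := abs_nonneg (θ i)
    constructor <;> linarith
  have hz0 : 0 < ‖z‖ := by
    have : 0 ≤ ∑ i, |θ i| := Finset.sum_nonneg fun _ _ => abs_nonneg _
    linarith
  rw [prodInvSqrt, norm_prod, ← Finset.mul_prod_erase _ _ (Finset.mem_univ (⟨0, hp⟩ : Fin p))]
  have hrest : ∏ i ∈ Finset.univ.erase (⟨0, hp⟩ : Fin p), ‖((θ i : ℂ) - z) ^ (-(1 / 2) : ℂ)‖ ≤ 1 := by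
    refine Finset.prod_le_one (fun _ _ => norm_nonneg _) fun i _ => ?_
    rw [norm_cpow_neg_half]
    exact inv_le_one_of_one_le₀ (Real.one_le_sqrt.2 (hfac i).2)
  refine (mul_le_of_le_one_right (norm_nonneg _) hrest).trans ?_
  rw [norm_cpow_neg_half, Real.rpow_neg hz0.le, ← Real.sqrt_eq_rpow, ← div_eq_mul_inv,
    inv_eq_one_div, div_le_div_iff₀ (Real.sqrt_pos.2 (one_pos.trans_le (hfac _).2))
      (Real.sqrt_pos.2 hz0), one_mul]
  refine Real.sqrt_le_iff.2 ⟨by positivity, ?_⟩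
  rw [mul_pow, Real.sq_sqrt (norm_nonneg _)]
  linarith [(hfac ⟨0, hp⟩).1, hz0]

/-! ### The Stieltjes representation -/

theorem inv_norm_le_of_le_abs_im {z : ℂ} {c : ℝ} (hc : 0 < c) (h : c ≤ |z.im|) :
    ‖z‖⁻¹ ≤ (1 + c⁻¹) * (1 + |z.re|)⁻¹ := by
  have h1 := Complex.abs_re_le_norm z
  have h2 := h.trans (Complex.abs_im_le_norm z)
  have hz : 0 < ‖z‖ := hc.trans_le h2
  rw [inv_eq_one_div, ← div_eq_mul_inv, div_le_div_iff₀ hz (by positivity), one_mul]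
  have : 1 ≤ c⁻¹ * ‖z‖ := by
    rw [inv_mul_eq_div]
    exact (one_le_div hc).2 h2
  linarith

theorem inv_norm_sub_le {z w : ℂ} (hz : 0 < ‖z‖) (h : 2 * ‖w‖ ≤ ‖z‖) : ‖z - w‖⁻¹ ≤ 2 * ‖z‖⁻¹ := by
  have := norm_sub_norm_le z w
  rw [inv_eq_one_div, ← div_eq_mul_inv, div_le_div_iff₀ (by linarith) hz]
  linarith

theorem integrable_prodInvSqrtBoundary_div (hp : 1 ≤ p) (hθ : Function.Injective θ) {w : ℂ}
    (hw : w.im ≠ 0) : Integrable (fun t : ℝ => prodInvSqrtBoundary θ t / (t - w)) := by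
  refine ((integrable_prod_inv_sqrt_mul_inv_one_add_abs hp hθ).const_mul
    ((1 + |w.re|) * (1 + |w.im|⁻¹))).mono' ?_ (ae_of_all _ fun t => ?_)
  · exact (measurable_prodInvSqrtBoundary.div (by fun_prop)).aestronglyMeasurable
  · rw [norm_div, norm_prodInvSqrtBoundary, div_eq_mul_inv]
    have h1 := inv_norm_le_of_le_abs_im (z := (t : ℂ) - w) (abs_pos.2 hw) (by simp)
    have h3 : 1 + |t| ≤ (1 + |w.re|) * (1 + |t - w.re|) := by
      have := abs_add_le (t - w.re) w.re
      rw [sub_add_cancel] at this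
      nlinarith [mul_nonneg (abs_nonneg w.re) (abs_nonneg (t - w.re))]
    have h2 : (1 + |((t : ℂ) - w).re|)⁻¹ ≤ (1 + |w.re|) * (1 + |t|)⁻¹ := by
      simp only [Complex.sub_re, Complex.ofReal_re]
      rw [inv_eq_one_div, ← div_eq_mul_inv, div_le_div_iff₀ (by positivity) (by positivity)]
      linarith
    have hP : 0 ≤ ∏ i, (√|t - θ i|)⁻¹ := Finset.prod_nonneg fun _ _ => by positivity
    calc _ ≤ (∏ i, (√|t - θ i|)⁻¹) * ((1 + |w.im|⁻¹) * ((1 + |w.re|) * (1 + |t|)⁻¹)) := by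
          refine mul_le_mul_of_nonneg_left (h1.trans ?_) hP
          exact mul_le_mul_of_nonneg_left h2 (by positivity)
      _ = _ := by ring

/-- The pole `-iu` lies in the lower half-plane, so the quotient is holomorphic above the real axis
and the contour argument applies directly. -/
theorem integral_prodInvSqrtBoundary_div_add (hp : 1 ≤ p) (hθ : Function.Injective θ) {u : ℝ}
    (hu : 0 < u) : ∫ t : ℝ, prodInvSqrtBoundary θ t / (t + u * Complex.I) = 0 := by
  obtain ⟨R₀, hR₀⟩ := exists_norm_prodInvSqrt_le hp θ
  have hne : ∀ z : ℂ, 0 < z.im → z + u * Complex.I ≠ 0 := by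
    intro z hz h0
    have := congrArg Complex.im h0
    simp at this
    linarith
  refine integral_boundaryValue_eq_zero (F := fun z => prodInvSqrt θ z / (z + u * Complex.I))
    (h := fun t => (1 + u⁻¹) * ((∏ i, (√|t - θ i|)⁻¹) * (1 + |t|)⁻¹)) (C := 4)
    (R₀ := max R₀ (max 1 (2 * u))) (δ := 1) one_pos ?_ ?_ ?_ ?_ ?_
  · exact differentiableOn_prodInvSqrt.fun_div (by fun_prop) fun z hz => hne z hz
  · intro z hz _
    have hz1 : 1 ≤ ‖z‖ := (le_max_left _ _).trans ((le_max_right _ _).trans hz)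
    have hz2 : 2 * u ≤ ‖z‖ := (le_max_right _ _).trans ((le_max_right _ _).trans hz)
    have hz0 : 0 < ‖z‖ := by linarith
    have h1 := inv_norm_sub_le (z := z) (w := -(u * Complex.I)) hz0
      (by simpa [abs_of_pos hu] using hz2)
    rw [sub_neg_eq_add] at h1
    have h2 := hR₀ z ((le_max_left _ _).trans hz)
    rw [norm_div, div_eq_mul_inv]
    calc _ ≤ (2 * ‖z‖ ^ (-(1 / 2) : ℝ)) * (2 * ‖z‖⁻¹) := by gcongr
      _ = 4 * (‖z‖ ^ (-(1 / 2) : ℝ) * ‖z‖ ^ (-1 : ℝ)) := by rw [Real.rpow_neg_one]; ring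
      _ = _ := by rw [← Real.rpow_add hz0]; norm_num
  · exact (integrable_prod_inv_sqrt_mul_inv_one_add_abs hp hθ).const_mul _
  · intro ε hε _
    filter_upwards [ae_ne_all θ] with t ht
    have h1 := inv_norm_le_of_le_abs_im (z := (t : ℂ) + ε * Complex.I + u * Complex.I) hu (by
      simp
      rw [abs_of_pos (by linarith)]
      linarith)
    simp only [Complex.add_re, Complex.ofReal_re, Complex.mul_re, Complex.I_re, mul_zero,
      Complex.ofReal_im, Complex.I_im, mul_one, sub_self, add_zero] at h1
    rw [norm_div, div_eq_mul_inv]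
    calc _ ≤ (∏ i, (√|t - θ i|)⁻¹) * ((1 + u⁻¹) * (1 + |t|)⁻¹) :=
          mul_le_mul (norm_prodInvSqrt_le ht ε) h1 (by positivity)
            (Finset.prod_nonneg fun _ _ => by positivity)
      _ = _ := by ring
  · filter_upwards [ae_ne_all θ] with t ht
    refine (tendsto_prodInvSqrt ht).div ?_ ?_
    · have : Continuous fun ε : ℝ => (t : ℂ) + ε * Complex.I + u * Complex.I := by fun_prop
      simpa using (this.tendsto 0).mono_left (nhdsWithin_le_nhds (s := Set.Ioi 0))
    · intro h0
      have := congrArg Complex.im h0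
      simp at this
      linarith

theorem integral_univ_inv_sq_add_sq {u : ℝ} (hu : 0 < u) :
    ∫ t : ℝ, (t ^ 2 + u ^ 2)⁻¹ = Real.pi / u := by
  have h := Measure.integral_comp_div (fun x : ℝ => (1 + x ^ 2)⁻¹) u
  rw [integral_univ_inv_one_add_sq, abs_of_pos hu, smul_eq_mul] at h
  have : (fun t : ℝ => (t ^ 2 + u ^ 2)⁻¹) = fun t => (u ^ 2)⁻¹ * (1 + (t / u) ^ 2)⁻¹ := by
    ext t
    rw [← mul_inv]
    congr 1
    field_simp
    ring
  rw [this, integral_const_mul, h]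
  field_simp

/-- This is Cauchy's formula at the pole `w = iu`. Subtracting `A / (z + w)`, which has the same
value at `w`, makes the singularity removable, and the subtracted term has an explicit integral. -/
theorem integral_prodInvSqrtBoundary_div_sub (hp : 1 ≤ p) (hθ : Function.Injective θ) {u : ℝ}
    (hu : 0 < u) : ∫ t : ℝ, prodInvSqrtBoundary θ t / (t - u * Complex.I)
      = 2 * Real.pi * Complex.I * prodInvSqrt θ (u * Complex.I) := by
  obtain ⟨R₀, hR₀⟩ := exists_norm_prodInvSqrt_le hp θ
  set w : ℂ := u * Complex.I with hw
  -- At `z = w` the denominator `z + w` equals `2 * w`, so this `A` makes `K` vanish at `w`; `dslope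
  -- K w` is then the holomorphic extension of `K z / (z - w)`.
  set A : ℂ := prodInvSqrt θ w * (2 * w) with hA
  have hwn : ‖w‖ = u := by simp [hw, abs_of_pos hu]
  have hwim : w.im = u := by simp [hw]
  have hwre : w.re = 0 := by simp [hw]
  have hw0 : w ≠ 0 := by rw [← norm_pos_iff, hwn]; exact hu
  have hadd : ∀ z : ℂ, 0 ≤ z.im → z + w ≠ 0 := by
    intro z hz h0
    have := congrArg Complex.im h0
    simp [hwim] at this
    linarith
  have hsub : ∀ z : ℂ, z.im < u → z - w ≠ 0 := by
    intro z hz h0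
    have := congrArg Complex.im h0
    simp [hwim] at this
    linarith
  set K : ℂ → ℂ := fun z => prodInvSqrt θ z - A / (z + w) with hK
  have hKw : K w = 0 := by
    simp only [hK, hA]
    field_simp
    ring
  have hds : ∀ z, z ≠ w → dslope K w z = (prodInvSqrt θ z - A / (z + w)) / (z - w) := by
    intro z hz
    rw [dslope_of_ne _ hz, slope_def_field, hKw, sub_zero]
  have hint2 : Integrable (fun t : ℝ => ((1 + |t|)⁻¹) ^ 2) := by
    refine integrable_inv_one_add_sq.mono' (by fun_prop) (ae_of_all _ fun t => ?_)
    rw [Real.norm_of_nonneg (by positivity), inv_pow]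
    gcongr
    rw [← sq_abs t]
    nlinarith [abs_nonneg t]
  have hzero : ∫ t : ℝ, (prodInvSqrtBoundary θ t - A / (t + w)) / (t - w) = 0 := by
    -- With `δ = u / 2` the approaching lines stay at distance at least `u / 2` below the pole.
    refine integral_boundaryValue_eq_zero (F := dslope K w)
      (h := fun t => (1 + (u / 2)⁻¹) * ((∏ i, (√|t - θ i|)⁻¹) * (1 + |t|)⁻¹)
        + (1 + (u / 2)⁻¹) * (‖A‖ * (1 + u⁻¹)) * ((1 + |t|)⁻¹) ^ 2) (C := 4 + 4 * ‖A‖)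
      (R₀ := max R₀ (max 1 (2 * u))) (δ := u / 2) (by linarith) ?_ ?_ ?_ ?_ ?_
    · rw [Complex.differentiableOn_dslope]
      · exact differentiableOn_prodInvSqrt.fun_sub (DifferentiableOn.fun_div (by fun_prop)
          (by fun_prop) fun z hz => hadd z (le_of_lt hz))
      · refine (isOpen_lt continuous_const Complex.continuous_im).mem_nhds ?_
        simpa [hwim] using hu
    · intro z hz _
      have hz1 : 1 ≤ ‖z‖ := (le_max_left _ _).trans ((le_max_right _ _).trans hz)
      have hz2 : 2 * u ≤ ‖z‖ := (le_max_right _ _).trans ((le_max_right _ _).trans hz)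
      have hz0 : 0 < ‖z‖ := by linarith
      have hzw : z ≠ w := by
        rintro rfl
        linarith
      have h1 := inv_norm_sub_le (z := z) (w := w) hz0 (by rwa [hwn])
      have h1' := inv_norm_sub_le (z := z) (w := -w) hz0 (by rwa [norm_neg, hwn])
      rw [sub_neg_eq_add] at h1'
      have h2 := hR₀ z ((le_max_left _ _).trans hz)
      have h3 : ‖z‖⁻¹ ≤ ‖z‖ ^ (-(1 / 2) : ℝ) := by
        rw [← Real.rpow_neg_one]
        exact Real.rpow_le_rpow_of_exponent_le hz1 (by norm_num)
      rw [hds z hzw, norm_div, div_eq_mul_inv]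
      have h4 : ‖prodInvSqrt θ z - A / (z + w)‖ ≤ (2 + 2 * ‖A‖) * ‖z‖ ^ (-(1 / 2) : ℝ) := by
        refine (norm_sub_le _ _).trans ?_
        rw [norm_div, div_eq_mul_inv, add_mul]
        refine add_le_add h2 ?_
        calc ‖A‖ * ‖z + w‖⁻¹ ≤ ‖A‖ * (2 * ‖z‖ ^ (-(1 / 2) : ℝ)) := by
              gcongr
              linarith
          _ = _ := by ring
      calc _ ≤ ((2 + 2 * ‖A‖) * ‖z‖ ^ (-(1 / 2) : ℝ)) * (2 * ‖z‖⁻¹) := by gcongr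
        _ = (4 + 4 * ‖A‖) * (‖z‖ ^ (-(1 / 2) : ℝ) * ‖z‖ ^ (-1 : ℝ)) := by
          rw [Real.rpow_neg_one]; ring
        _ = _ := by rw [← Real.rpow_add hz0]; norm_num
    · exact ((integrable_prod_inv_sqrt_mul_inv_one_add_abs hp hθ).const_mul _).add
        (hint2.const_mul _)
    · intro ε hε hεu
      filter_upwards [ae_ne_all θ] with t ht
      have hzim : ((t : ℂ) + ε * Complex.I).im = ε := by simp
      have hzre : ((t : ℂ) + ε * Complex.I).re = t := by simp
      have h1 := inv_norm_le_of_le_abs_im (z := (t : ℂ) + ε * Complex.I + w) hu (by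
        rw [Complex.add_im, hzim, hwim, abs_of_pos (by linarith)]
        linarith)
      have h2 := inv_norm_le_of_le_abs_im (z := (t : ℂ) + ε * Complex.I - w)
        (c := u / 2) (by linarith) (by
        rw [Complex.sub_im, hzim, hwim, abs_of_neg (by linarith)]
        linarith)
      rw [Complex.add_re, hzre, hwre, add_zero] at h1
      rw [Complex.sub_re, hzre, hwre, sub_zero] at h2
      rw [hds _ (sub_ne_zero.1 (hsub _ (by rw [hzim]; linarith))), norm_div, div_eq_mul_inv]
      have h4 : ‖prodInvSqrt θ (t + ε * Complex.I) - A / (t + ε * Complex.I + w)‖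
          ≤ (∏ i, (√|t - θ i|)⁻¹) + ‖A‖ * ((1 + u⁻¹) * (1 + |t|)⁻¹) := by
        refine (norm_sub_le _ _).trans (add_le_add (norm_prodInvSqrt_le ht ε) ?_)
        rw [norm_div, div_eq_mul_inv]
        gcongr
      have hP : 0 ≤ ∏ i, (√|t - θ i|)⁻¹ := Finset.prod_nonneg fun _ _ => by positivity
      calc _ ≤ ((∏ i, (√|t - θ i|)⁻¹) + ‖A‖ * ((1 + u⁻¹) * (1 + |t|)⁻¹))
              * ((1 + (u / 2)⁻¹) * (1 + |t|)⁻¹) :=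
            mul_le_mul h4 h2 (by positivity) (by positivity)
        _ = _ := by ring
    · filter_upwards [ae_ne_all θ] with t ht
      have hc : Tendsto (fun ε : ℝ => (t : ℂ) + ε * Complex.I) (𝓝[>] 0) (𝓝 t) := by
        have : Continuous fun ε : ℝ => (t : ℂ) + ε * Complex.I := by fun_prop
        simpa using (this.tendsto 0).mono_left (nhdsWithin_le_nhds (s := Set.Ioi 0))
      have hlim := ((tendsto_prodInvSqrt ht).sub ((tendsto_const_nhds (x := A)).div
        (hc.add_const w) (hadd t (by simp)))).div (hc.sub_const w) (hsub t (by simpa using hu))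
      refine hlim.congr' ?_
      filter_upwards [Ioo_mem_nhdsGT hu] with ε hε
      exact (hds _ (sub_ne_zero.1 (hsub _ (by simpa using hε.2)))).symm
  -- Here `(t + w) * (t - w) = t ^ 2 + u ^ 2`, so the integral is `A * π / u`, and `2 * w / u = 2i`.
  have hcl : ∫ t : ℝ, A / (t + w) / (t - w) = 2 * Real.pi * Complex.I * prodInvSqrt θ w := by
    have : ∀ t : ℝ, A / (t + w) / (t - w) = A * (((t ^ 2 + u ^ 2)⁻¹ : ℝ) : ℂ) := by
      intro t
      rw [div_div, div_eq_mul_inv]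
      congr 2
      push_cast
      congr 1
      rw [hw]
      ring_nf
      rw [Complex.I_sq]
      ring
    simp_rw [this]
    rw [integral_const_mul, integral_complex_ofReal, integral_univ_inv_sq_add_sq hu, hA, hw]
    push_cast
    have : (u : ℂ) ≠ 0 := by exact_mod_cast hu.ne'
    field_simp
  have hI1 := integrable_prodInvSqrtBoundary_div hp hθ (w := w) (by rw [hwim]; exact hu.ne')
  have hI2 : Integrable (fun t : ℝ => A / (t + w) / (t - w)) := by
    refine (hint2.const_mul (‖A‖ * (1 + u⁻¹) ^ 2)).mono' (Measurable.aestronglyMeasurable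
      (by fun_prop)) (ae_of_all _ fun t => ?_)
    have h1 := inv_norm_le_of_le_abs_im (z := (t : ℂ) + w) hu (by simp [hwim, le_abs_self])
    have h2 := inv_norm_le_of_le_abs_im (z := (t : ℂ) - w) hu (by simp [hwim, le_abs_self])
    simp only [Complex.add_re, Complex.sub_re, Complex.ofReal_re, hwre, add_zero, sub_zero] at h1 h2
    rw [norm_div, norm_div, div_eq_mul_inv, div_eq_mul_inv]
    calc _ ≤ ‖A‖ * ((1 + u⁻¹) * (1 + |t|)⁻¹) * ((1 + u⁻¹) * (1 + |t|)⁻¹) := by gcongr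
      _ = _ := by ring
  simp_rw [sub_div] at hzero
  rw [integral_sub hI1 hI2, hcl] at hzero
  exact sub_eq_zero.1 hzero

/-- The Stieltjes representation of `prodInvSqrt` on the imaginary axis. -/
theorem integral_im_prodInvSqrtBoundary_div (hp : 1 ≤ p) (hθ : Function.Injective θ) {u : ℝ}
    (hu : 0 < u) : ∫ t : ℝ, ((prodInvSqrtBoundary θ t).im : ℂ) / (t - u * Complex.I)
      = Real.pi * prodInvSqrt θ (u * Complex.I) := by
  have hconj : ∫ t : ℝ, (starRingEnd ℂ) (prodInvSqrtBoundary θ t) / (t - u * Complex.I) = 0 := by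
    have h := congrArg (starRingEnd ℂ) (integral_prodInvSqrtBoundary_div_add hp hθ hu)
    rw [← integral_conj, map_zero] at h
    rw [← h]
    refine integral_congr_ae (ae_of_all _ fun t => ?_)
    simp [sub_eq_add_neg]
  have hI1 := integrable_prodInvSqrtBoundary_div hp hθ (w := u * Complex.I) (by simpa using hu.ne')
  have hI2 : Integrable (fun t : ℝ =>
      (starRingEnd ℂ) (prodInvSqrtBoundary θ t) / (t - u * Complex.I)) := by
    have h := integrable_prodInvSqrtBoundary_div hp hθ (w := -(u * Complex.I))
      (by simpa using hu.ne')
    refine h.norm.mono' ?_ (ae_of_all _ fun t => ?_)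
    · exact ((Complex.continuous_conj.measurable.comp measurable_prodInvSqrtBoundary).div
        (by fun_prop)).aestronglyMeasurable
    · rw [norm_div, norm_div, RCLike.norm_conj, ← RCLike.norm_conj ((t : ℂ) - u * Complex.I)]
      simp
  have h := integral_sub hI1 hI2
  rw [hconj, sub_zero, integral_prodInvSqrtBoundary_div_sub hp hθ hu] at h
  -- Half the difference with the conjugate, over `I`, is the imaginary part; the conjugate integral
  -- vanishes by `hconj`, so only the residue at `iu` survives.
  have he : ∀ t : ℝ, ((prodInvSqrtBoundary θ t).im : ℂ) / (t - u * Complex.I)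
      = (2 * Complex.I)⁻¹ * (prodInvSqrtBoundary θ t / (t - u * Complex.I)
        - (starRingEnd ℂ) (prodInvSqrtBoundary θ t) / (t - u * Complex.I)) := by
    intro t
    rw [← sub_div, Complex.sub_conj]
    push_cast
    field_simp
  simp_rw [he]
  rw [integral_const_mul, h]
  field_simp

end

/-! ### Exponential transforms of chi-square combinations -/

theorem ofReal_mul_cpow {r : ℝ} (hr : 0 < r) {w : ℂ} (hw : w ≠ 0) (s : ℂ) :
    ((r : ℂ) * w) ^ s = (r : ℂ) ^ s * w ^ s := by
  have hr' : (r : ℂ) ≠ 0 := by exact_mod_cast hr.ne'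
  rw [Complex.cpow_def_of_ne_zero (mul_ne_zero hr' hw), Complex.cpow_def_of_ne_zero hr',
    Complex.cpow_def_of_ne_zero hw, Complex.log_ofReal_mul hr hw, add_mul, Complex.exp_add,
    Complex.ofReal_log hr.le]

theorem integral_cexp_mul_sq_gaussianReal {z : ℂ} (hz : z.re < 1 / 2) :
    ∫ x, Complex.exp (z * ((x ^ 2 : ℝ) : ℂ)) ∂gaussianReal 0 1 = (1 - 2 * z) ^ (-(1 / 2) : ℂ) := by
  have hre : 0 < (1 / 2 - z).re := by
    simp only [Complex.sub_re, Complex.div_ofNat_re, Complex.one_re]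
    linarith
  have hre2 : 0 < (1 - 2 * z).re := by
    simp
    linarith
  rw [integral_gaussianReal_eq_integral_smul one_ne_zero]
  have h1 : ∀ x : ℝ, gaussianPDFReal 0 1 x • Complex.exp (z * ((x ^ 2 : ℝ) : ℂ))
      = ((√(2 * Real.pi))⁻¹ : ℝ) * Complex.exp (-(1 / 2 - z) * (x : ℂ) ^ 2) := by
    intro x
    rw [gaussianPDFReal_def]
    simp only [NNReal.coe_one, mul_one, sub_zero, Complex.real_smul]
    push_cast
    rw [mul_assoc, ← Complex.exp_add]
    congr 2
    ring
  simp_rw [h1]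
  rw [integral_const_mul, integral_gaussian_complex hre]
  -- The positive real factor `2π` splits off from the principal power, and its square root cancels
  -- the normalising constant of the Gaussian density.
  have h2 : (Real.pi : ℂ) / (1 / 2 - z) = ((2 * Real.pi : ℝ) : ℂ) * (1 - 2 * z)⁻¹ := by
    have : (1 - 2 * z) ≠ 0 := fun h => by rw [h] at hre2; simp at hre2
    have h' : (1 / 2 - z) ≠ 0 := fun h => by rw [h] at hre; simp at hre
    rw [div_eq_iff h']
    push_cast
    field_simp
  have hpi : (0 : ℝ) < 2 * Real.pi := by positivity
  have hne : (1 - 2 * z) ≠ 0 := fun h => by rw [h] at hre2; simp at hre2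
  have harg : (1 - 2 * z).arg ≠ Real.pi := Complex.slitPlane_arg_ne_pi (Or.inl hre2)
  rw [h2, ofReal_mul_cpow hpi (inv_ne_zero hne), Complex.inv_cpow _ _ harg, Complex.cpow_neg,
    ← mul_assoc]
  have h3 : ((2 * Real.pi : ℝ) : ℂ) ^ (1 / 2 : ℂ) = (√(2 * Real.pi) : ℝ) := by
    rw [Real.sqrt_eq_rpow, Complex.ofReal_cpow hpi.le]
    push_cast
    rfl
  rw [h3, ← Complex.ofReal_mul, inv_mul_cancel₀ (Real.sqrt_pos.2 hpi).ne', Complex.ofReal_one,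
    one_mul]

theorem isProbabilityMeasure_chiSquared (n : ℕ) : IsProbabilityMeasure (chiSquared n) :=
  Measure.isProbabilityMeasure_map (Measurable.aemeasurable (by fun_prop))

theorem integral_cexp_mul_chiSquared (n : ℕ) {z : ℂ} (hz : z.re < 1 / 2) :
    ∫ x, Complex.exp (z * (x : ℂ)) ∂chiSquared n = ((1 - 2 * z) ^ (-(1 / 2) : ℂ)) ^ n := by
  rw [chiSquared, integral_map (Measurable.aemeasurable (by fun_prop)) (by fun_prop)]
  have h : ∀ y : Fin n → ℝ, Complex.exp (z * ((∑ j, y j ^ 2 : ℝ) : ℂ))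
      = ∏ j, Complex.exp (z * ((y j ^ 2 : ℝ) : ℂ)) := by
    intro y
    rw [← Complex.exp_sum, ← Finset.mul_sum]
    push_cast
    rfl
  simp_rw [h]
  rw [integral_fintype_prod_eq_prod (fun (_ : Fin n) (x : ℝ) => Complex.exp (z * ((x ^ 2 : ℝ) : ℂ)))]
  simp_rw [integral_cexp_mul_sq_gaussianReal hz]
  simp

theorem isProbabilityMeasure_chiSqCombLaw {p : ℕ} (θ : Fin p → ℝ) (n : Fin p → ℕ) :
    IsProbabilityMeasure (chiSqCombLaw θ n) := by
  have := fun i => isProbabilityMeasure_chiSquared (n i)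
  exact Measure.isProbabilityMeasure_map (Measurable.aemeasurable (by fun_prop))

/-- The closed half-plane `z.re ≤ 0` covers both uses: the imaginary axis for characteristic
functions, and `iu - θ₀` for the transform of the distribution function. -/
theorem integral_cexp_mul_chiSqCombLaw {p : ℕ} {θ : Fin p → ℝ} (hθ : ∀ i, 0 < θ i) (n : Fin p → ℕ)
    {z : ℂ} (hz : z.re ≤ 0) :
    ∫ x, Complex.exp (z * (x : ℂ)) ∂chiSqCombLaw θ n
      = ∏ i, ((1 - z / θ i) ^ (-(1 / 2) : ℂ)) ^ n i := by
  have := fun i => isProbabilityMeasure_chiSquared (n i)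
  rw [chiSqCombLaw, integral_map (Measurable.aemeasurable (by fun_prop)) (by fun_prop)]
  have h : ∀ y : Fin p → ℝ, Complex.exp (z * ((∑ i, 1 / (2 * θ i) * y i : ℝ) : ℂ))
      = ∏ i, Complex.exp (z / (2 * θ i) * (y i : ℂ)) := by
    intro y
    rw [← Complex.exp_sum]
    push_cast
    rw [Finset.mul_sum]
    congr 1
    exact Finset.sum_congr rfl fun i _ => by ring
  simp_rw [h]
  rw [integral_fintype_prod_eq_prod (fun (i : Fin p) (x : ℝ) => Complex.exp (z / (2 * θ i) * (x : ℂ)))]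
  refine Finset.prod_congr rfl fun i _ => ?_
  rw [integral_cexp_mul_chiSquared]
  · congr 2
    have : (θ i : ℂ) ≠ 0 := by exact_mod_cast (hθ i).ne'
    field_simp
  · have : (z / (2 * θ i)).re = z.re / (2 * θ i) := by
      rw [← Complex.div_ofReal_re]; push_cast; rfl
    rw [this]
    have := div_nonpos_of_nonpos_of_nonneg hz (by linarith [hθ i] : (0 : ℝ) ≤ 2 * θ i)
    linarith

/-! ### Densities determined by characteristic functions -/

section

variable {μ : Measure ℝ} {f g : ℝ → ℝ}

theorem nonneg_of_ae_nonneg_of_continuousOn (hc : ContinuousOn f (Set.Ioi 0))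
    (h : ∀ᵐ s ∂volume.restrict (Set.Ioi 0), 0 ≤ f s) {s : ℝ} (hs : 0 < s) : 0 ≤ f s := by
  by_contra! hneg
  have hopen : IsOpen (Set.Ioi 0 ∩ f ⁻¹' Set.Iio 0) := hc.isOpen_inter_preimage isOpen_Ioi isOpen_Iio
  have hpos := hopen.measure_pos volume ⟨s, hs, hneg⟩
  rw [ae_restrict_iff' measurableSet_Ioi] at h
  refine hpos.ne' (measure_mono_null ?_ (ae_iff.1 h))
  rintro x ⟨hx, hfx⟩ hx'
  exact absurd (hx' hx) (not_le.2 hfx)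

theorem charFun_add_measure {μ ν : Measure ℝ} [IsFiniteMeasure μ] [IsFiniteMeasure ν] (t : ℝ) :
    charFun (μ + ν) t = charFun μ t + charFun ν t := by
  have hi : ∀ (κ : Measure ℝ) [IsFiniteMeasure κ],
      Integrable (fun x : ℝ => Complex.exp (t * x * Complex.I)) κ := by
    intro κ _
    refine (integrable_const (1 : ℝ)).mono' (by fun_prop) (ae_of_all _ fun x => ?_)
    rw [← Complex.ofReal_mul, Complex.norm_exp_ofReal_mul_I]
  rw [charFun_apply_real, charFun_apply_real, charFun_apply_real,
    integral_add_measure (hi μ) (hi ν)]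

theorem charFun_withDensity_ofReal (hf : IntegrableOn f (Set.Ioi 0)) (t : ℝ) :
    charFun ((volume.restrict (Set.Ioi 0)).withDensity fun s => ENNReal.ofReal (f s)) t
      = ∫ s in Set.Ioi (0 : ℝ), Complex.exp (t * s * Complex.I) * ((max (f s) 0 : ℝ) : ℂ) := by
  rw [charFun_apply_real, integral_withDensity_eq_integral_toReal_smul₀
    hf.aemeasurable.ennreal_ofReal (ae_of_all _ fun _ => ENNReal.ofReal_lt_top)]
  refine integral_congr_ae (ae_of_all _ fun s => ?_)
  simp only [ENNReal.toReal_ofReal', Complex.real_smul, mul_comm]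

/-- Negative arguments follow by conjugation and `0` by continuity. The Stieltjes representation
only gives information for `u > 0`. -/
theorem ext_of_charFun_pos {μ ν : Measure ℝ} [IsFiniteMeasure μ] [IsFiniteMeasure ν]
    (h : ∀ t, 0 < t → charFun μ t = charFun ν t) : μ = ν := by
  refine Measure.ext_of_charFun (Continuous.ext_on (dense_compl_singleton (0 : ℝ))
    continuous_charFun continuous_charFun fun t ht => ?_)
  rcases lt_or_gt_of_ne (show t ≠ 0 from ht) with h0 | h0
  · rw [← neg_neg t, charFun_neg (-t), charFun_neg (-t), h _ (neg_pos.2 h0)]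
  · exact h t h0

/-- A finite measure whose characteristic function is the Fourier transform of an integrable
function on the positive half-line has this function as its density. -/
theorem isPosPDF_of_charFun [IsFiniteMeasure μ] (hc : ContinuousOn f (Set.Ioi 0))
    (hf : IntegrableOn f (Set.Ioi 0))
    (h : ∀ t, 0 < t → charFun μ t = ∫ s in Set.Ioi (0 : ℝ), Complex.exp (t * s * Complex.I) * (f s : ℂ)) :
    IsPosPDF μ f := by
  set ν₁ := (volume.restrict (Set.Ioi 0)).withDensity fun s => ENNReal.ofReal (f s) with hν₁
  set ν₂ := (volume.restrict (Set.Ioi 0)).withDensity fun s => ENNReal.ofReal (-f s) with hν₂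
  have hfn : IntegrableOn (fun s => -f s) (Set.Ioi 0) := hf.neg
  have : IsFiniteMeasure ν₁ := isFiniteMeasure_withDensity_ofReal hf.2
  have : IsFiniteMeasure ν₂ := isFiniteMeasure_withDensity_ofReal hfn.2
  have hexp : ∀ t : ℝ, ∀ g : ℝ → ℝ, IntegrableOn g (Set.Ioi 0) →
      IntegrableOn (fun s : ℝ => Complex.exp (t * s * Complex.I) * ((max (g s) 0 : ℝ) : ℂ))
        (Set.Ioi 0) := by
    intro t g hg
    refine Integrable.bdd_mul (c := 1) (Integrable.ofReal hg.pos_part) (by fun_prop)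
      (ae_of_all _ fun s => ?_)
    rw [← Complex.ofReal_mul, Complex.norm_exp_ofReal_mul_I]
  -- Moving the negative part of `f` to the side of `μ` turns the identity of transforms into one
  -- between finite positive measures.
  have hsum : μ + ν₂ = ν₁ := by
    refine ext_of_charFun_pos fun t ht => ?_
    rw [charFun_add_measure, h t ht, hν₁, hν₂, charFun_withDensity_ofReal hf,
      charFun_withDensity_ofReal hfn, ← eq_sub_iff_add_eq,
      ← integral_sub (hexp t f hf) (hexp t _ hfn)]
    refine integral_congr_ae (ae_of_all _ fun s => ?_)
    simp only
    rw [← mul_sub, ← Complex.ofReal_sub, max_zero_sub_max_neg_zero_eq_self]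
  have hae : ∀ᵐ s ∂volume.restrict (Set.Ioi 0), 0 ≤ f s := by
    -- `ν₂ ≤ ν₁` makes the negative part of `f` at most its positive part almost everywhere; as one
    -- of the two is always zero, the negative part vanishes.
    have hle : (fun s => ENNReal.ofReal (-f s)) ≤ᵐ[volume.restrict (Set.Ioi 0)]
        fun s => ENNReal.ofReal (f s) := by
      refine ae_le_of_forall_setLIntegral_le_of_sigmaFinite₀ hfn.aemeasurable.ennreal_ofReal
        fun s hs _ => ?_
      rw [← withDensity_apply _ hs, ← withDensity_apply _ hs, ← hν₁, ← hν₂, ← hsum]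
      simp
    filter_upwards [hle] with s hs
    by_contra! hneg
    rw [ENNReal.ofReal_of_nonpos hneg.le, nonpos_iff_eq_zero, ENNReal.ofReal_eq_zero] at hs
    linarith
  refine ⟨hc, fun s hs => nonneg_of_ae_nonneg_of_continuousOn hc hae hs, ?_⟩
  have hzero : ν₂ = 0 := by
    rw [hν₂, withDensity_eq_zero_iff hfn.aemeasurable.ennreal_ofReal]
    filter_upwards [hae] with s hs
    simpa using hs
  rw [← hν₁, ← hsum, hzero, add_zero]

theorem IsPosPDF.eq_of_pos [IsFiniteMeasure μ] (hf : IsPosPDF μ f) (hg : IsPosPDF μ g) {s : ℝ}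
    (hs : 0 < s) : f s = g s := by
  have hmf := (hf.continuousOn.aemeasurable measurableSet_Ioi (μ := volume)).ennreal_ofReal
  have hmg := (hg.continuousOn.aemeasurable measurableSet_Ioi (μ := volume)).ennreal_ofReal
  have hae : ∀ᵐ s ∂volume.restrict (Set.Ioi 0), f s = g s := by
    have h := (withDensity_eq_iff_of_sigmaFinite hmf hmg).1 (hf.eq_withDensity.symm.trans hg.eq_withDensity)
    filter_upwards [h, ae_restrict_mem measurableSet_Ioi] with s hs hs0
    exact (ENNReal.ofReal_eq_ofReal_iff (hf.nonneg s hs0) (hg.nonneg s hs0)).1 hs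
  refine le_antisymm ?_ ?_
  · exact sub_nonneg.1 (nonneg_of_ae_nonneg_of_continuousOn
      (hg.continuousOn.sub hf.continuousOn) (hae.mono fun s h => by simp [h]) hs)
  · exact sub_nonneg.1 (nonneg_of_ae_nonneg_of_continuousOn
      (hf.continuousOn.sub hg.continuousOn) (hae.mono fun s h => by simp [h]) hs)

end

/-! ### The cut intervals and the imaginary part of the boundary value -/

section

variable {p : ℕ} {θ : Fin p → ℝ}

/-- By monotonicity the indices with `θ j < t` form an initial segment, so its cardinality locates
`t` among the `θ j`. -/
theorem lt_iff_lt_card_filter (hθ : StrictMono θ) (t : ℝ) (i : Fin p) :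
    θ i < t ↔ (i : ℕ) < (Finset.univ.filter fun j => θ j < t).card := by
  constructor
  · intro h
    have : Finset.Iic i ⊆ Finset.univ.filter fun j => θ j < t := fun j hj =>
      Finset.mem_filter.2 ⟨Finset.mem_univ _, (hθ.monotone (Finset.mem_Iic.1 hj)).trans_lt h⟩
    have := Finset.card_le_card this
    rw [Fin.card_Iic] at this
    omega
  · intro h
    by_contra! hle
    have : (Finset.univ.filter fun j => θ j < t) ⊆ Finset.Iio i := fun j hj =>
      Finset.mem_Iio.2 (hθ.lt_iff_lt.1 ((Finset.mem_filter.1 hj).2.trans_le hle))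
    have := Finset.card_le_card this
    rw [Fin.card_Iio] at this
    omega

theorem mem_cutInterval_iff (hθ : StrictMono θ) {t : ℝ} (ht : ∀ i, t ≠ θ i)
    (r : Fin ((p + 1) / 2)) :
    t ∈ cutInterval θ r ↔ (Finset.univ.filter fun j => θ j < t).card = 2 * (r : ℕ) + 1 := by
  have hk : (Finset.univ.filter fun j => θ j < t).card ≤ p := by
    simpa using Finset.card_le_univ (Finset.univ.filter fun j => θ j < t)
  rw [cutInterval]
  split_ifs with h
  · rw [Set.mem_Ioo, lt_iff_lt_card_filter hθ, ← not_le (a := θ ⟨2 * (r : ℕ) + 1, h⟩),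
      (ht _).symm.le_iff_lt, lt_iff_lt_card_filter hθ]
    simp only
    omega
  -- In the unbounded case `2 * r + 1 = p`, so a count above `2 * r` must equal `p`.
  · rw [Set.mem_Ioi, lt_iff_lt_card_filter hθ]
    simp only
    omega

theorem measurableSet_cutInterval (r : Fin ((p + 1) / 2)) : MeasurableSet (cutInterval θ r) := by
  rw [cutInterval]
  split_ifs
  exacts [measurableSet_Ioo, measurableSet_Ioi]

theorem prodInvSqrtBoundary_eq {t : ℝ} (ht : ∀ i, t ≠ θ i) :
    prodInvSqrtBoundary θ t = Complex.I ^ (Finset.univ.filter fun j => θ j < t).card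
      * ((∏ i, (√|t - θ i|)⁻¹ : ℝ) : ℂ) := by
  rw [prodInvSqrtBoundary, Finset.prod_mul_distrib, Finset.prod_ite, Finset.prod_const_one, one_mul,
    Finset.prod_const, Complex.ofReal_prod]
  congr 3
  refine Finset.filter_congr fun i _ => ?_
  rw [not_lt, (ht i).symm.le_iff_lt]

/-- On a cut interval an odd number of factors `θ i - t` is negative, so the radicand is positive
and equals `∏ i, |t - θ i|`. -/
theorem cutIntegrand_eq_of_mem (hθ : StrictMono θ) (s : ℝ) {t : ℝ} (ht : ∀ i, t ≠ θ i)
    {r : Fin ((p + 1) / 2)} (hr : t ∈ cutInterval θ r) :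
    cutIntegrand θ s t = Real.exp (-(s * t)) * ∏ i, (√|t - θ i|)⁻¹ := by
  have hprod : ∏ i, (θ i - t) = (-1) ^ (Finset.univ.filter fun j => θ j < t).card
      * ∏ i, |t - θ i| := by
    rw [← Finset.prod_const, Finset.prod_filter, ← Finset.prod_mul_distrib]
    refine Finset.prod_congr rfl fun i _ => ?_
    split_ifs with h
    · rw [abs_of_pos (sub_pos.2 h)]; ring
    · rw [abs_of_nonpos (sub_nonpos.2 (not_lt.1 h))]; ring
  rw [cutIntegrand, hprod, (mem_cutInterval_iff hθ ht r).1 hr, pow_succ, pow_mul]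
  simp only [even_two, Even.neg_pow, one_pow, mul_neg, mul_one, neg_mul, one_mul, neg_neg]
  rw [Real.sqrt_prod _ fun _ _ => abs_nonneg _, Finset.prod_inv_distrib, div_eq_mul_inv]

theorem im_I_pow_odd (r : ℕ) : (Complex.I ^ (2 * r + 1)).im = (-1) ^ r := by
  rw [pow_succ, pow_mul, Complex.I_sq]
  have : ((-1 : ℂ)) ^ r = (((-1) ^ r : ℝ) : ℂ) := by push_cast; rfl
  rw [this, mul_comm, Complex.im_mul_ofReal, Complex.I_im, one_mul]

theorem im_I_pow_even (r : ℕ) : (Complex.I ^ (2 * r)).im = 0 := by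
  rw [pow_mul, Complex.I_sq]
  have : ((-1 : ℂ)) ^ r = (((-1) ^ r : ℝ) : ℂ) := by push_cast; rfl
  rw [this, Complex.ofReal_im]

/-- The count of `θ j` below `t` selects at most one interval: none if it is even, and the one with
index `r` if it is `2 * r + 1`, where `I ^ (2 * r + 1)` contributes the sign. -/
theorem sum_indicator_cutInterval (hθ : StrictMono θ) (s : ℝ) {t : ℝ} (ht : ∀ i, t ≠ θ i) :
    ∑ r : Fin ((p + 1) / 2), (-1 : ℝ) ^ (r : ℕ) * (cutInterval θ r).indicator (cutIntegrand θ s) t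
      = Real.exp (-(s * t)) * (prodInvSqrtBoundary θ t).im := by
  have hk : (Finset.univ.filter fun j => θ j < t).card ≤ p := by
    simpa using Finset.card_le_univ (Finset.univ.filter fun j => θ j < t)
  rw [prodInvSqrtBoundary_eq ht, Complex.im_mul_ofReal]
  rcases Nat.even_or_odd' (Finset.univ.filter fun j => θ j < t).card with ⟨m, hm | hm⟩
  · rw [hm, im_I_pow_even, zero_mul, mul_zero]
    refine Finset.sum_eq_zero fun r _ => ?_
    rw [Set.indicator_of_notMem, mul_zero]
    rw [mem_cutInterval_iff hθ ht]
    omega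
  · rw [hm, im_I_pow_odd]
    have hmem : t ∈ cutInterval θ (⟨m, by omega⟩ : Fin ((p + 1) / 2)) :=
      (mem_cutInterval_iff hθ ht _).2 hm
    rw [Finset.sum_eq_single ⟨m, by omega⟩]
    · rw [Set.indicator_of_mem hmem, cutIntegrand_eq_of_mem hθ s ht hmem]
      ring
    · intro r _ hr
      rw [Set.indicator_of_notMem, mul_zero]
      rw [mem_cutInterval_iff hθ ht]
      intro h
      exact hr (Fin.ext (by simp only; omega))
    · simp

/-- This confines integrals written over all of `ℝ` to positive `t`, where `exp (-(s * t))` decays.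
-/
theorem prodInvSqrtBoundary_im_eq_zero {t : ℝ} (ht : ∀ i, t < θ i) :
    (prodInvSqrtBoundary θ t).im = 0 := by
  rw [prodInvSqrtBoundary_eq fun i => (ht i).ne, Finset.filter_false_of_mem fun i _ => (ht i).le.not_gt,
    Finset.card_empty, pow_zero, one_mul, Complex.ofReal_im]

theorem abs_im_prodInvSqrtBoundary_le (t : ℝ) :
    |(prodInvSqrtBoundary θ t).im| ≤ ∏ i, (√|t - θ i|)⁻¹ :=
  (Complex.abs_im_le_norm _).trans_eq (norm_prodInvSqrtBoundary t)

theorem exp_neg_mul_le {s₀ s t : ℝ} (hs₀ : 0 < s₀) (hs : s₀ ≤ s) (ht : 0 ≤ t) :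
    Real.exp (-(s * t)) ≤ (1 + s₀⁻¹) * (1 + |t|)⁻¹ := by
  rw [abs_of_nonneg ht, Real.exp_neg, inv_eq_one_div, ← div_eq_mul_inv,
    div_le_div_iff₀ (Real.exp_pos _) (by positivity), one_mul]
  have h1 := Real.add_one_le_exp (s * t)
  have h2 : s₀ * t ≤ s * t := by gcongr
  have h3 : 1 + t ≤ (1 + s₀⁻¹) * (1 + s₀ * t) := by
    have : s₀⁻¹ * (s₀ * t) = t := by field_simp
    have h4 : 0 ≤ s₀ * t := by positivity
    have h5 : 0 < s₀⁻¹ := by positivity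
    nlinarith
  refine h3.trans ?_
  gcongr
  linarith

theorem cutInterval_subset_Ioi (hθ_pos : ∀ i, 0 < θ i) (r : Fin ((p + 1) / 2)) :
    cutInterval θ r ⊆ Set.Ioi 0 := by
  intro t ht
  rw [cutInterval] at ht
  split_ifs at ht
  · exact (hθ_pos _).trans ht.1
  · exact (hθ_pos _).trans ht

theorem integrableOn_cutIntegrand (hp : 1 ≤ p) (hθ_pos : ∀ i, 0 < θ i) (hθ : StrictMono θ) {s : ℝ}
    (hs : 0 < s) (r : Fin ((p + 1) / 2)) : IntegrableOn (cutIntegrand θ s) (cutInterval θ r) := by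
  refine Integrable.mono' ((integrable_prod_inv_sqrt_mul_inv_one_add_abs hp
    hθ.injective).const_mul (1 + s⁻¹)).integrableOn ?_ ?_
  · unfold cutIntegrand
    exact Measurable.aestronglyMeasurable (by fun_prop)
  · filter_upwards [ae_restrict_of_ae (ae_ne_all θ), ae_restrict_mem (measurableSet_cutInterval r)]
      with t ht htr
    have hP : 0 ≤ ∏ i, (√|t - θ i|)⁻¹ := Finset.prod_nonneg fun _ _ => by positivity
    rw [cutIntegrand_eq_of_mem hθ s ht htr, Real.norm_of_nonneg (by positivity)]
    calc _ ≤ ((1 + s⁻¹) * (1 + |t|)⁻¹) * ∏ i, (√|t - θ i|)⁻¹ := by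
          gcongr
          exact exp_neg_mul_le hs le_rfl (le_of_lt (cutInterval_subset_Ioi hθ_pos r htr))
      _ = _ := by ring

theorem cutDensity_eq_integral (hp : 1 ≤ p) (hθ_pos : ∀ i, 0 < θ i) (hθ : StrictMono θ) {s : ℝ}
    (hs : 0 < s) : cutDensity θ s = (∏ i, √(θ i)) / Real.pi
      * ∫ t, Real.exp (-(s * t)) * (prodInvSqrtBoundary θ t).im := by
  rw [cutDensity]
  congr 1
  have h : ∀ᵐ t : ℝ, Real.exp (-(s * t)) * (prodInvSqrtBoundary θ t).im =
      ∑ r : Fin ((p + 1) / 2), (-1 : ℝ) ^ (r : ℕ)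
        * (cutInterval θ r).indicator (cutIntegrand θ s) t := by
    filter_upwards [ae_ne_all θ] with t ht
    exact (sum_indicator_cutInterval hθ s ht).symm
  rw [integral_congr_ae h, integral_finsetSum]
  · refine Finset.sum_congr rfl fun r _ => ?_
    rw [integral_const_mul, integral_indicator (measurableSet_cutInterval r)]
  · intro r _
    exact ((integrable_indicator_iff (measurableSet_cutInterval r)).2
      (integrableOn_cutIntegrand hp hθ_pos hθ hs r)).const_mul _

theorem exp_mul_abs_im_le (hθ_pos : ∀ i, 0 < θ i) {s₀ s : ℝ} (hs₀ : 0 < s₀) (hs : s₀ ≤ s)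
    (t : ℝ) : Real.exp (-(s * t)) * |(prodInvSqrtBoundary θ t).im|
      ≤ (1 + s₀⁻¹) * ((∏ i, (√|t - θ i|)⁻¹) * (1 + |t|)⁻¹) := by
  have hP : 0 ≤ ∏ i, (√|t - θ i|)⁻¹ := Finset.prod_nonneg fun _ _ => by positivity
  rcases le_or_gt t 0 with ht | ht
  · rw [prodInvSqrtBoundary_im_eq_zero fun i => ht.trans_lt (hθ_pos i), abs_zero, mul_zero]
    positivity
  · calc _ ≤ ((1 + s₀⁻¹) * (1 + |t|)⁻¹) * ∏ i, (√|t - θ i|)⁻¹ :=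
          mul_le_mul (exp_neg_mul_le hs₀ hs ht.le) (abs_im_prodInvSqrtBoundary_le t)
            (abs_nonneg _) (by positivity)
      _ = _ := by ring

theorem continuousOn_cutDensity (hp : 1 ≤ p) (hθ_pos : ∀ i, 0 < θ i) (hθ : StrictMono θ) :
    ContinuousOn (cutDensity θ) (Set.Ioi 0) := by
  have hm := measurable_prodInvSqrtBoundary (θ := θ)
  refine ContinuousOn.congr (f := fun s => (∏ i, √(θ i)) / Real.pi
      * ∫ t, Real.exp (-(s * t)) * (prodInvSqrtBoundary θ t).im) ?_
    fun s hs => cutDensity_eq_integral hp hθ_pos hθ hs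
  refine continuousOn_const.mul fun s hs => ContinuousAt.continuousWithinAt ?_
  have hs0 : 0 < s := hs
  -- Using `s / 2` makes the bound uniform on a neighbourhood of `s`.
  refine continuousAt_of_dominated (bound := fun t => (1 + (s / 2)⁻¹)
    * ((∏ i, (√|t - θ i|)⁻¹) * (1 + |t|)⁻¹)) ?_ ?_ ?_ ?_
  · exact Eventually.of_forall fun s => Measurable.aestronglyMeasurable
      (Measurable.mul (by fun_prop) (Complex.measurable_im.comp hm))
  · filter_upwards [Ioi_mem_nhds (show s / 2 < s by linarith)] with x hx
    refine ae_of_all _ fun t => ?_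
    rw [norm_mul, Real.norm_of_nonneg (Real.exp_pos _).le]
    exact exp_mul_abs_im_le hθ_pos (by linarith) (le_of_lt hx) t
  · exact (integrable_prod_inv_sqrt_mul_inv_one_add_abs hp hθ.injective).const_mul _
  · exact ae_of_all _ fun t => by fun_prop

/-- The singularity of `t⁻¹` at `0` is harmless because the imaginary part vanishes below the
smallest `θ`. -/
theorem inv_mul_abs_im_le (hp : 1 ≤ p) (hθ_pos : ∀ i, 0 < θ i) (hθ : StrictMono θ) (t : ℝ) :
    |(prodInvSqrtBoundary θ t).im| * t⁻¹
      ≤ (1 + (θ ⟨0, hp⟩)⁻¹) * ((∏ i, (√|t - θ i|)⁻¹) * (1 + |t|)⁻¹) := by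
  have hP : 0 ≤ ∏ i, (√|t - θ i|)⁻¹ := Finset.prod_nonneg fun _ _ => by positivity
  have h0 := hθ_pos ⟨0, hp⟩
  rcases lt_or_ge t (θ ⟨0, hp⟩) with ht | ht
  · rw [prodInvSqrtBoundary_im_eq_zero fun i => ht.trans_le (hθ.monotone (Nat.zero_le i)), abs_zero,
      zero_mul]
    positivity
  · have htpos : 0 < t := h0.trans_le ht
    have h1 : t⁻¹ ≤ (1 + (θ ⟨0, hp⟩)⁻¹) * (1 + |t|)⁻¹ := by
      rw [abs_of_pos htpos, inv_eq_one_div, ← div_eq_mul_inv, div_le_div_iff₀ htpos (by positivity),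
        one_mul]
      have : 1 ≤ (θ ⟨0, hp⟩)⁻¹ * t := by
        rw [inv_mul_eq_div]
        exact (one_le_div h0).2 ht
      linarith
    calc _ ≤ (∏ i, (√|t - θ i|)⁻¹) * ((1 + (θ ⟨0, hp⟩)⁻¹) * (1 + |t|)⁻¹) :=
          mul_le_mul (abs_im_prodInvSqrtBoundary_le t) h1 (by positivity) hP
      _ = _ := by ring

/-! ### The Fourier transform of the cut density -/

theorem integrable_cexp_mul_im_prod (hp : 1 ≤ p) (hθ_pos : ∀ i, 0 < θ i) (hθ : StrictMono θ)
    (u : ℝ) : Integrable (Function.uncurry fun s t : ℝ =>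
      Complex.exp ((u * Complex.I - t) * s) * ((prodInvSqrtBoundary θ t).im : ℂ))
      ((volume.restrict (Set.Ioi 0)).prod volume) := by
  have hm := measurable_prodInvSqrtBoundary (θ := θ)
  have hm2 : Measurable fun t => ((prodInvSqrtBoundary θ t).im : ℂ) :=
    Complex.measurable_ofReal.comp (Complex.measurable_im.comp hm)
  have hnorm : ∀ s t : ℝ, ‖Complex.exp ((u * Complex.I - t) * s)‖ = Real.exp (-t * s) := by
    intro s t
    rw [Complex.norm_exp]
    congr 1
    simp
  refine (integrable_prod_iff' ?_).2 ⟨?_, ?_⟩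
  · refine Measurable.aestronglyMeasurable ?_
    simp only [Function.uncurry_def]
    exact Measurable.mul (by fun_prop) (hm2.comp measurable_snd)
  · refine ae_of_all _ fun t => ?_
    rcases le_or_gt t 0 with ht | ht
    · simp [prodInvSqrtBoundary_im_eq_zero fun i => ht.trans_lt (hθ_pos i)]
    · have hre : (u * Complex.I - t : ℂ).re < 0 := by simpa using ht
      exact (integrableOn_exp_mul_complex_Ioi hre 0).mul_const ((prodInvSqrtBoundary θ t).im : ℂ)
  · have heq : ∀ t : ℝ, ∫ s in Set.Ioi (0 : ℝ), ‖Function.uncurry (fun s t : ℝ =>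
        Complex.exp ((u * Complex.I - t) * s) * ((prodInvSqrtBoundary θ t).im : ℂ)) (s, t)‖
        = |(prodInvSqrtBoundary θ t).im| * t⁻¹ := by
      intro t
      simp only [Function.uncurry_apply_pair, norm_mul, hnorm, Complex.norm_real, Real.norm_eq_abs]
      rw [integral_mul_const]
      rcases le_or_gt t 0 with ht | ht
      · simp [prodInvSqrtBoundary_im_eq_zero fun i => ht.trans_lt (hθ_pos i)]
      · rw [integral_exp_mul_Ioi (by simpa using ht)]
        simp [mul_comm]
    simp_rw [heq]
    refine ((integrable_prod_inv_sqrt_mul_inv_one_add_abs hp hθ.injective).const_mul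
      (1 + (θ ⟨0, hp⟩)⁻¹)).mono' (Measurable.aestronglyMeasurable
        (Measurable.mul (Complex.measurable_im.comp hm).norm (by fun_prop)))
      (ae_of_all _ fun t => ?_)
    refine le_trans (le_of_eq ?_) (inv_mul_abs_im_le hp hθ_pos hθ t)
    rw [norm_mul, Real.norm_eq_abs, abs_abs, Real.norm_eq_abs]
    rcases le_or_gt t 0 with ht | ht
    · simp [prodInvSqrtBoundary_im_eq_zero fun i => ht.trans_lt (hθ_pos i)]
    · rw [abs_of_pos (inv_pos.2 ht)]

theorem cexp_mul_cutDensity_eq (hp : 1 ≤ p) (hθ_pos : ∀ i, 0 < θ i) (hθ : StrictMono θ) (u : ℝ)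
    {s : ℝ} (hs : 0 < s) : Complex.exp (u * s * Complex.I) * (cutDensity θ s : ℂ)
      = (((∏ i, √(θ i)) / Real.pi : ℝ) : ℂ) * ∫ t : ℝ,
        Complex.exp ((u * Complex.I - t) * s) * ((prodInvSqrtBoundary θ t).im : ℂ) := by
  rw [cutDensity_eq_integral hp hθ_pos hθ hs, Complex.ofReal_mul, ← integral_complex_ofReal,
    mul_left_comm, ← integral_const_mul]
  congr 2
  ext t
  push_cast
  rw [← mul_assoc, ← Complex.exp_add]
  congr 2
  ring

theorem integrableOn_cutDensity (hp : 1 ≤ p) (hθ_pos : ∀ i, 0 < θ i) (hθ : StrictMono θ) :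
    IntegrableOn (cutDensity θ) (Set.Ioi 0) := by
  -- At `u = 0` the inner integral over `t` is the cut density itself, up to its constant, so Fubini
  -- gives integrability in `s`.
  have h := ((integrable_cexp_mul_im_prod hp hθ_pos hθ 0).integral_prod_left.const_mul
    ((((∏ i, √(θ i)) / Real.pi : ℝ) : ℂ))).re
  refine h.congr ?_
  filter_upwards [ae_restrict_mem measurableSet_Ioi] with s hs
  have := cexp_mul_cutDensity_eq hp hθ_pos hθ 0 hs
  simp only [Function.uncurry_apply_pair]
  rw [← this]
  simp

theorem integral_cexp_mul_cutDensity (hp : 1 ≤ p) (hθ_pos : ∀ i, 0 < θ i) (hθ : StrictMono θ)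
    {u : ℝ} (hu : 0 < u) :
    ∫ s in Set.Ioi (0 : ℝ), Complex.exp (u * s * Complex.I) * (cutDensity θ s : ℂ)
      = ((∏ i, √(θ i) : ℝ) : ℂ) * prodInvSqrt θ (u * Complex.I) := by
  rw [setIntegral_congr_fun measurableSet_Ioi fun s hs => cexp_mul_cutDensity_eq hp hθ_pos hθ u hs,
    integral_const_mul, integral_integral_swap (integrable_cexp_mul_im_prod hp hθ_pos hθ u)]
  have hinner : ∀ t : ℝ, ∫ s in Set.Ioi (0 : ℝ),
      Complex.exp ((u * Complex.I - t) * s) * ((prodInvSqrtBoundary θ t).im : ℂ)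
      = ((prodInvSqrtBoundary θ t).im : ℂ) / (t - u * Complex.I) := by
    intro t
    rw [integral_mul_const]
    rcases le_or_gt t 0 with ht | ht
    · simp [prodInvSqrtBoundary_im_eq_zero fun i => ht.trans_lt (hθ_pos i)]
    · rw [integral_exp_mul_complex_Ioi (by simpa using ht), Complex.ofReal_zero, mul_zero,
        Complex.exp_zero, neg_div, ← div_neg, neg_sub, one_div_mul_eq_div]
  simp_rw [hinner]
  rw [integral_im_prodInvSqrtBoundary_div hp hθ.injective hu]
  have : (Real.pi : ℂ) ≠ 0 := by exact_mod_cast Real.pi_ne_zero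
  push_cast
  field_simp

/-- `1 - z / a` is the positive multiple `a⁻¹` of `a - z`, and principal powers are multiplicative
for a positive real factor. -/
theorem one_sub_div_cpow_neg_half {a : ℝ} (ha : 0 < a) {z : ℂ} (hz : z ≠ a) :
    (1 - z / a) ^ (-(1 / 2) : ℂ) = (√a : ℝ) * ((a : ℂ) - z) ^ (-(1 / 2) : ℂ) := by
  have ha' : (a : ℂ) ≠ 0 := by exact_mod_cast ha.ne'
  have h1 : 1 - z / a = ((a⁻¹ : ℝ) : ℂ) * ((a : ℂ) - z) := by
    push_cast
    field_simp
  rw [h1, ofReal_mul_cpow (inv_pos.2 ha) (sub_ne_zero.2 hz.symm),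
    ofReal_cpow_neg_half (inv_pos.2 ha).le, Real.sqrt_inv, inv_inv]

theorem isPosPDF_cutDensity (hp : 1 ≤ p) (hθ_pos : ∀ i, 0 < θ i) (hθ : StrictMono θ) :
    IsPosPDF (chiSqCombLaw θ fun _ => 1) (cutDensity θ) := by
  have := isProbabilityMeasure_chiSqCombLaw θ fun _ => 1
  refine isPosPDF_of_charFun (continuousOn_cutDensity hp hθ_pos hθ)
    (integrableOn_cutDensity hp hθ_pos hθ) fun u hu => ?_
  rw [integral_cexp_mul_cutDensity hp hθ_pos hθ hu, charFun_apply_real]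
  simp_rw [mul_right_comm _ _ Complex.I]
  rw [integral_cexp_mul_chiSqCombLaw hθ_pos _ (by simp), prodInvSqrt, Complex.ofReal_prod,
    ← Finset.prod_mul_distrib]
  refine Finset.prod_congr rfl fun i _ => ?_
  rw [pow_one, one_sub_div_cpow_neg_half (hθ_pos i)]
  intro h
  have := congrArg Complex.im h
  simp at this
  exact hu.ne' this

end

/-! ### The distribution function and the augmented variable -/

theorem continuousAt_measureReal_Iic {μ : Measure ℝ} [IsFiniteMeasure μ] {x : ℝ} (hx : μ {x} = 0) :
    ContinuousAt (fun x => μ.real (Set.Iic x)) x := by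
  have heq : (fun x => μ.real (Set.Iic x)) = fun x => ∫ y, (Set.Iic x).indicator (1 : ℝ → ℝ) y ∂μ := by
    ext x
    rw [integral_indicator_one measurableSet_Iic]
  rw [heq]
  refine continuousAt_of_dominated (bound := fun _ => 1) ?_ ?_ (integrable_const _) ?_
  · exact Eventually.of_forall fun x =>
      (measurable_one.indicator measurableSet_Iic).aestronglyMeasurable
  · exact Eventually.of_forall fun x => ae_of_all _ fun y =>
      (norm_indicator_le_norm_self _ _).trans (by simp)
  · have hne : ∀ᵐ y ∂μ, y ≠ x := by
      rw [ae_iff]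
      simpa using hx
    filter_upwards [hne] with y hy
    rcases lt_or_gt_of_ne hy with h | h
    · refine (continuousAt_const (y := (1 : ℝ))).congr ?_
      filter_upwards [Ioi_mem_nhds h] with x hx
      rw [Set.indicator_of_mem (Set.mem_Iic.2 (le_of_lt hx))]
      rfl
    · refine (continuousAt_const (y := (0 : ℝ))).congr ?_
      filter_upwards [Iio_mem_nhds h] with x hx
      rw [Set.indicator_of_notMem (fun h' => absurd (Set.mem_Iic.1 h') (not_le.2 hx))]

/-- The Laplace transform of the distribution function of a measure carried by `(0, ∞)`. -/
theorem integral_cexp_mul_measureReal_Iic {μ : Measure ℝ} [IsFiniteMeasure μ]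
    (hμ : ∀ᵐ y ∂μ, 0 < y) {a : ℂ} (ha : a.re < 0) :
    ∫ x in Set.Ioi (0 : ℝ), Complex.exp (a * x) * (μ.real (Set.Iic x) : ℂ)
      = -(1 / a) * ∫ y, Complex.exp (a * y) ∂μ := by
  have hint : Integrable (Function.uncurry fun x y : ℝ =>
      Complex.exp (a * x) * (Set.Iic x).indicator (1 : ℝ → ℂ) y)
      ((volume.restrict (Set.Ioi 0)).prod μ) := by
    have h1 := (integrableOn_exp_mul_complex_Ioi ha 0).norm
    refine (Integrable.comp_fst h1 μ).mono' ?_ (ae_of_all _ fun q => ?_)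
    · refine Measurable.aestronglyMeasurable ?_
      have : (Function.uncurry fun x y : ℝ =>
          Complex.exp (a * x) * (Set.Iic x).indicator (1 : ℝ → ℂ) y)
          = fun q => Complex.exp (a * q.1) * {q : ℝ × ℝ | q.2 ≤ q.1}.indicator (1 : ℝ × ℝ → ℂ) q := by
        ext ⟨x, y⟩
        simp [Set.indicator_apply]
      rw [this]
      exact Measurable.mul (by fun_prop) (measurable_one.indicator
        (measurableSet_le measurable_snd measurable_fst))
    · rw [Function.uncurry_def, norm_mul]
      refine mul_le_of_le_one_right (norm_nonneg _) ?_
      exact (norm_indicator_le_norm_self _ _).trans (by simp)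
  have hF : ∀ x : ℝ, Complex.exp (a * x) * (μ.real (Set.Iic x) : ℂ)
      = ∫ y, Complex.exp (a * x) * (Set.Iic x).indicator (1 : ℝ → ℂ) y ∂μ := by
    intro x
    rw [integral_const_mul, Pi.one_def, integral_indicator_const _ measurableSet_Iic]
    simp
  simp_rw [hF]
  rw [integral_integral_swap hint, ← integral_const_mul]
  refine integral_congr_ae ?_
  filter_upwards [hμ] with y hy
  -- After Fubini the inner integral runs over `x ≥ y`, which lies inside `(0, ∞)` because `y > 0`,
  -- and equals `-exp (a * y) / a`.
  have hind : ∀ x : ℝ, Complex.exp (a * x) * (Set.Iic x).indicator (1 : ℝ → ℂ) y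
      = (Set.Ici y).indicator (fun x : ℝ => Complex.exp (a * x)) x := by
    intro x
    by_cases h : y ≤ x <;> simp [h]
  simp_rw [hind]
  rw [integral_indicator measurableSet_Ici, Measure.restrict_restrict measurableSet_Ici,
    Set.inter_eq_left.2 (Set.Ici_subset_Ioi.2 hy), integral_Ici_eq_integral_Ioi,
    integral_exp_mul_complex_Ioi ha]
  ring

section

variable {p : ℕ} {θ : Fin p → ℝ}

theorem IsPosPDF.ae_pos {μ : Measure ℝ} {f : ℝ → ℝ} (h : IsPosPDF μ f) : ∀ᵐ y ∂μ, 0 < y := by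
  rw [h.eq_withDensity]
  exact (withDensity_absolutelyContinuous _ _).ae_le (ae_restrict_mem measurableSet_Ioi)

theorem IsPosPDF.measure_singleton {μ : Measure ℝ} {f : ℝ → ℝ} (h : IsPosPDF μ f) (x : ℝ) :
    μ {x} = 0 := by
  rw [h.eq_withDensity]
  exact withDensity_absolutelyContinuous _ _ (MeasureTheory.measure_singleton x)

theorem augParam_pos (hθ_pos : ∀ i, 0 < θ i) {θ₀ : ℝ} (hθ₀ : 0 < θ₀) (i : Fin (p + 1)) :
    0 < augParam θ θ₀ i := by
  refine Fin.cases hθ₀ (fun i => ?_) i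
  exact add_pos (hθ_pos i) hθ₀

/-- The density of the augmented variable in terms of the distribution function. -/
theorem isPosPDF_augmented (hp : 1 ≤ p) (hθ_pos : ∀ i, 0 < θ i) (hθ : StrictMono θ) {θ₀ : ℝ}
    (hθ₀ : 0 < θ₀) :
    IsPosPDF (chiSqCombLaw (augParam θ θ₀) (augDof p)) fun x =>
      (θ₀ * ∏ i, √(θ i + θ₀)) / (∏ i, √(θ i))
        * (Real.exp (-θ₀ * x) * (chiSqCombLaw θ fun _ => 1).real (Set.Iic x)) := by
  have := isProbabilityMeasure_chiSqCombLaw θ fun _ => 1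
  have := isProbabilityMeasure_chiSqCombLaw (augParam θ θ₀) (augDof p)
  have hL := isPosPDF_cutDensity hp hθ_pos hθ
  have hcont : Continuous fun x => (chiSqCombLaw θ fun _ => 1).real (Set.Iic x) :=
    continuous_iff_continuousAt.2 fun x => continuousAt_measureReal_Iic (hL.measure_singleton x)
  refine isPosPDF_of_charFun (Continuous.continuousOn (by fun_prop)) ?_ fun u hu => ?_
  · refine Integrable.const_mul ?_ _
    refine (integrableOn_exp_mul_Ioi (neg_neg_of_pos hθ₀) 0).mul_bdd (c := 1)
      hcont.aestronglyMeasurable (ae_of_all _ fun x => ?_)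
    rw [Real.norm_of_nonneg measureReal_nonneg]
    exact measureReal_le_one
  -- The damping factor `exp (-θ₀ x)` shifts the transform variable to `a`, and `θ i - a = (θ i +
  -- θ₀) - iu` produces the augmented parameters.
  · set a : ℂ := u * Complex.I - θ₀ with ha
    have hare : a.re < 0 := by simpa [ha] using hθ₀
    have hRHS : ∀ s : ℝ, Complex.exp (u * s * Complex.I)
        * (((θ₀ * ∏ i, √(θ i + θ₀)) / (∏ i, √(θ i))
          * (Real.exp (-θ₀ * s) * (chiSqCombLaw θ fun _ => 1).real (Set.Iic s)) : ℝ) : ℂ)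
        = (((θ₀ * ∏ i, √(θ i + θ₀)) / (∏ i, √(θ i)) : ℝ) : ℂ)
          * (Complex.exp (a * s) * ((chiSqCombLaw θ fun _ => 1).real (Set.Iic s) : ℂ)) := by
      intro s
      have : Complex.exp (a * s) = Complex.exp (u * s * Complex.I) * (Real.exp (-θ₀ * s) : ℝ) := by
        rw [Complex.ofReal_exp, ← Complex.exp_add]
        congr 1
        rw [ha]
        push_cast
        ring
      rw [this, Complex.ofReal_mul, Complex.ofReal_mul]
      ring
    simp_rw [hRHS]
    rw [integral_const_mul, integral_cexp_mul_measureReal_Iic hL.ae_pos hare,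
      integral_cexp_mul_chiSqCombLaw hθ_pos _ hare.le, charFun_apply_real]
    simp_rw [mul_right_comm _ _ Complex.I]
    rw [integral_cexp_mul_chiSqCombLaw (augParam_pos hθ_pos hθ₀) _ (by simp), Fin.prod_univ_succ]
    simp only [augParam, augDof, Fin.cons_zero, Fin.cons_succ, pow_one]
    have hne : ∀ b : ℝ, (u * Complex.I : ℂ) ≠ b := by
      intro b h
      have := congrArg Complex.im h
      simp at this
      exact hu.ne' this
    have hfac : ∀ i, (1 - a / θ i) ^ (-(1 / 2) : ℂ)
        = (√(θ i) : ℝ) * (((θ i + θ₀ : ℝ) : ℂ) - u * Complex.I) ^ (-(1 / 2) : ℂ) := by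
      intro i
      rw [one_sub_div_cpow_neg_half (hθ_pos i)]
      · congr 2
        rw [ha]
        push_cast
        ring
      · intro h
        rw [ha, sub_eq_iff_eq_add, ← Complex.ofReal_add] at h
        exact hne _ h
    have hfac' : ∀ i, (1 - u * Complex.I / ((θ i + θ₀ : ℝ) : ℂ)) ^ (-(1 / 2) : ℂ)
        = (√(θ i + θ₀) : ℝ) * (((θ i + θ₀ : ℝ) : ℂ) - u * Complex.I) ^ (-(1 / 2) : ℂ) :=
      fun i => one_sub_div_cpow_neg_half (add_pos (hθ_pos i) hθ₀) (hne _)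
    -- Two degrees of freedom are needed here: the square removes the root, leaving the factor `-(1
    -- / a)` that comes from integrating the distribution.
    have hsq : ((1 - u * Complex.I / θ₀) ^ (-(1 / 2) : ℂ)) ^ 2 = θ₀ * -(1 / a) := by
      rw [← Complex.cpow_nat_mul]
      have h0 : (θ₀ : ℂ) ≠ 0 := by exact_mod_cast hθ₀.ne'
      have ha0 : a ≠ 0 := sub_ne_zero.2 (hne _)
      have : (1 - u * Complex.I / θ₀) = (θ₀ * -(1 / a))⁻¹ := by
        rw [mul_inv, ← neg_inv, one_div, inv_inv, ha]
        field_simp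
        ring
      rw [this]
      norm_num [Complex.cpow_neg_one]
    simp_rw [hfac, hfac']
    rw [hsq, Finset.prod_mul_distrib, Finset.prod_mul_distrib, ← Complex.ofReal_prod,
      ← Complex.ofReal_prod]
    have hP : ((∏ i, √(θ i) : ℝ) : ℂ) ≠ 0 := by
      exact_mod_cast (Finset.prod_pos fun i _ => Real.sqrt_pos.2 (hθ_pos i)).ne'
    rw [Complex.ofReal_div, Complex.ofReal_mul]
    field_simp

/-- Uniqueness of the continuous density lets an arbitrary `f` be replaced by the explicit one,
which is then solved for the distribution function. -/
theorem measureReal_Iic_eq (hp : 1 ≤ p) (hθ_pos : ∀ i, 0 < θ i) (hθ : StrictMono θ) {θ₀ : ℝ}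
    (hθ₀ : 0 < θ₀) {f : ℝ → ℝ} (hf : IsPosPDF (chiSqCombLaw (augParam θ θ₀) (augDof p)) f) {x : ℝ}
    (hx : 0 < x) :
    (chiSqCombLaw θ fun _ => 1).real (Set.Iic x) = f x * (Real.exp (x * θ₀) * ∏ i, √(θ i)) /
      (θ₀ * ∏ i, √(θ i + θ₀)) := by
  have := isProbabilityMeasure_chiSqCombLaw (augParam θ θ₀) (augDof p)
  rw [hf.eq_of_pos (isPosPDF_augmented hp hθ_pos hθ hθ₀) hx]
  have h1 : ∏ i, √(θ i) ≠ 0 := (Finset.prod_pos fun i _ => Real.sqrt_pos.2 (hθ_pos i)).ne'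
  have h2 : ∏ i, √(θ i + θ₀) ≠ 0 :=
    (Finset.prod_pos fun i _ => Real.sqrt_pos.2 (add_pos (hθ_pos i) hθ₀)).ne'
  have h3 : Real.exp (-θ₀ * x) * Real.exp (x * θ₀) = 1 := by
    rw [← Real.exp_add, show -θ₀ * x + x * θ₀ = 0 by ring, Real.exp_zero]
  rw [eq_div_iff (mul_ne_zero hθ₀.ne' h2)]
  field_simp
  rw [show -(θ₀ * x) = -θ₀ * x by ring, mul_comm θ₀ x, mul_assoc, h3, mul_one]

/-! ### Scaling and passage to random variables -/

theorem augParam_mul (θ₀ x : ℝ) :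
    (fun i => augParam θ θ₀ i * x) = augParam (fun i => θ i * x) (θ₀ * x) := by
  ext i
  refine Fin.cases rfl (fun i => ?_) i
  simp only [augParam, Fin.cons_succ]
  ring

theorem measureReal_Iic_one_chiSqCombLaw_mul (n : Fin p → ℕ) {x : ℝ} (hx : 0 < x) :
    (chiSqCombLaw (fun i => θ i * x) n).real (Set.Iic 1) = (chiSqCombLaw θ n).real (Set.Iic x) := by
  rw [chiSqCombLaw, chiSqCombLaw, map_measureReal_apply (by fun_prop) measurableSet_Iic,
    map_measureReal_apply (by fun_prop) measurableSet_Iic]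
  congr 1
  ext c
  have : ∑ i, 1 / (2 * (θ i * x)) * c i = (∑ i, 1 / (2 * θ i) * c i) / x := by
    rw [Finset.sum_div]
    refine Finset.sum_congr rfl fun i _ => ?_
    rw [← mul_assoc, ← div_div]
    ring
  simp only [Set.mem_preimage, Set.mem_Iic]
  rw [this, div_le_one hx]

theorem measureReal_Iic_eq_scaled (hp : 1 ≤ p) (hθ_pos : ∀ i, 0 < θ i) (hθ : StrictMono θ) {θ₀ : ℝ}
    (hθ₀ : 0 < θ₀) {x : ℝ} (hx : 0 < x) {g : ℝ → ℝ}
    (hg : IsPosPDF (chiSqCombLaw (fun i => augParam θ θ₀ i * x) (augDof p)) g) :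
    (chiSqCombLaw θ fun _ => 1).real (Set.Iic x) = g 1 * (Real.exp (x * θ₀) * ∏ i, √(θ i)) /
      (x * θ₀ * ∏ i, √(θ i + θ₀)) := by
  rw [augParam_mul] at hg
  have h := measureReal_Iic_eq hp (fun i => mul_pos (hθ_pos i) hx) (hθ.mul_const hx)
    (mul_pos hθ₀ hx) hg one_pos
  rw [measureReal_Iic_one_chiSqCombLaw_mul _ hx] at h
  rw [h]
  -- Each product of roots gains the same factor `∏ √x`, which cancels; only the `x` in `θ₀ * x`
  -- remains, and the exponent is unchanged.
  simp_rw [← add_mul, Real.sqrt_mul' _ hx.le]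
  rw [Finset.prod_mul_distrib, Finset.prod_mul_distrib]
  have h1 : ∏ _i : Fin p, √x ≠ 0 := (Finset.prod_pos fun i _ => Real.sqrt_pos.2 hx).ne'
  rw [one_mul, mul_comm θ₀ x]
  rw [← mul_assoc (Real.exp _), ← mul_assoc (g 1), ← mul_assoc (x * θ₀), mul_div_mul_right _ _ h1]

theorem map_eq_chiSqCombLaw {n : Fin p → ℕ} {Ω : Type*} [MeasurableSpace Ω] {P : Measure Ω}
    [IsProbabilityMeasure P] {C : Fin p → Ω → ℝ} (hC_law : ∀ i, HasLaw (C i) (chiSquared (n i)) P)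
    (hC_indep : iIndepFun C P) :
    P.map (fun ω => ∑ i, 1 / (2 * θ i) * C i ω) = chiSqCombLaw θ n := by
  have hm : ∀ i, AEMeasurable (C i) P := fun i => (hC_law i).aemeasurable
  have h := (iIndepFun_iff_map_fun_eq_pi_map hm).1 hC_indep
  simp_rw [fun i => (hC_law i).map_eq] at h
  rw [chiSqCombLaw, ← h, AEMeasurable.map_map_of_aemeasurable
    (Measurable.aemeasurable (by fun_prop)) (aemeasurable_pi_lambda _ hm)]
  rfl

end

theorem theorem2 {p : ℕ} (hp : 1 ≤ p) (θ : Fin p → ℝ) (hθ_pos : ∀ i, 0 < θ i)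
    (hθ_mono : StrictMono θ)
    {Ω : Type*} [MeasurableSpace Ω] (P : Measure Ω) [IsProbabilityMeasure P]
    (C : Fin p → Ω → ℝ) (hC_law : ∀ i, HasLaw (C i) (chiSquared 1) P)
    (hC_indep : iIndepFun C P)
    (X : Ω → ℝ) (hX : ∀ ω, X ω = ∑ i, 1 / (2 * θ i) * C i ω) :
    -- the integrals converge, and the alternating sum is the density of `X`
    (∀ s : ℝ, 0 < s → ∀ r, IntegrableOn (cutIntegrand θ s) (cutInterval θ r)) ∧
    IsPosPDF (P.map X) (cutDensity θ) ∧
    -- the distribution function of `X`, through the density `f` of the augmented variable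
    (∀ θ₀ : ℝ, 0 < θ₀ →
      (∃ f, IsPosPDF (chiSqCombLaw (augParam θ θ₀) (augDof p)) f) ∧
      (∀ f, IsPosPDF (chiSqCombLaw (augParam θ θ₀) (augDof p)) f → ∀ x : ℝ, 0 < x →
        P.real {ω | X ω ≤ x} =
          f x * (Real.exp (x * θ₀) * ∏ i, Real.sqrt (θ i)) /
            (θ₀ * ∏ i, Real.sqrt (θ i + θ₀))) ∧
      (∀ x : ℝ, 0 < x →
        (∃ g, IsPosPDF (chiSqCombLaw (fun i => augParam θ θ₀ i * x) (augDof p)) g) ∧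
        (∀ g, IsPosPDF (chiSqCombLaw (fun i => augParam θ θ₀ i * x) (augDof p)) g →
          P.real {ω | X ω ≤ x} =
            g 1 * (Real.exp (x * θ₀) * ∏ i, Real.sqrt (θ i)) /
              (x * θ₀ * ∏ i, Real.sqrt (θ i + θ₀))))) := by
  obtain rfl : X = fun ω => ∑ i, 1 / (2 * θ i) * C i ω := funext hX
  have hmap := map_eq_chiSqCombLaw (θ := θ) (n := fun _ => 1) hC_law hC_indep
  have hm : AEMeasurable (fun ω => ∑ i, 1 / (2 * θ i) * C i ω) P :=
    Finset.aemeasurable_fun_sum _ fun i _ => (hC_law i).aemeasurable.const_mul _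
  have hcdf : ∀ x, P.real {ω | ∑ i, 1 / (2 * θ i) * C i ω ≤ x}
      = (chiSqCombLaw θ fun _ => 1).real (Set.Iic x) := by
    intro x
    rw [← hmap, map_measureReal_apply_of_aemeasurable hm measurableSet_Iic]
    rfl
  refine ⟨fun s hs r => integrableOn_cutIntegrand hp hθ_pos hθ_mono hs r, ?_, fun θ₀ hθ₀ =>
    ⟨⟨_, isPosPDF_augmented hp hθ_pos hθ_mono hθ₀⟩, fun f hf x hx => ?_, fun x hx => ⟨?_, fun g hg => ?_⟩⟩⟩
  · rw [hmap]
    exact isPosPDF_cutDensity hp hθ_pos hθ_mono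
  · rw [hcdf]
    exact measureReal_Iic_eq hp hθ_pos hθ_mono hθ₀ hf hx
  · rw [augParam_mul]
    exact ⟨_, isPosPDF_augmented hp (fun i => mul_pos (hθ_pos i) hx) (hθ_mono.mul_const hx)
      (mul_pos hθ₀ hx)⟩
  · rw [hcdf]
    exact measureReal_Iic_eq_scaled hp hθ_pos hθ_mono hθ₀ hx hg
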